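/- Notation. For $\mathbf x\in\mathbb R^n$ let $\{\mathbf x\}\in(-1/2,1/2]^n$ be its coordinatewise fractional part, $[x]=\{1,\dots,\lfloor x\rfloor\}$, and $\min^\times$ the minimum over nonzero values. Fix one norm $\|\cdot\|=\|\cdot\|_p$ with $p\in\{1,2,\infty\}$, and put $n^{1/\infty}=1$. - A short vector problem has as input $\alpha\ge 1$ and a nonsingular $M\in M_n(\mathbb Z)$; a solution is $\mathbf q_0\in\mathbb Z^n$ with $0<\|M\mathbf q_0\|\le\alpha\min^\times_{\mathbf q\in\mathbb Z^n}\|M\mathbf q\|$. - A simultaneous approximation problem $\mathrm{SAP}(\alpha,\mathbf x)$ has as input $\alpha\ge1$ and $\mathbf x\in\mathbb Q^n$; a solution is $q_0\in\mathbb Z$ with $0<\|\{q_0\mathbf x\}\|\le\alpha\min^\times_{q\in\mathbb Z}\|\{q\mathbf x\}\|$. - A good Diophantine approximation problem $\mathrm{GDA}(\alpha,\mathbf x,N)$ has as input $\alpha,N\ge1$ and $\mathbf x\in\mathbb Q^n$; a solution is $q_0\in[\alpha N]$ with $\|\{q_0\mathbf x\}\|\le\alpha\min_{q\in[N]}\|\{q\mathbf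 x\}\|$. For polynomials $f_1,f_2\in\mathbb Z[x]$ with larger degree $d$, let $C(f_1,f_2)$ be the $2d\times2d$ matrix whose first $d$ columns are the successive downward shifts of the coefficient vector $(f_{1,d},\dots,f_{1,0})$ and whose last $d$ columns are those of $(f_{2,d},\dots,f_{2,0})$ (so $\det C(f_1,f_2)=1$ if $d=0$). Algorithm. Input: integers $a\ge b\ge1$, $\alpha=a/b$, and $M\in M_n(\mathbb Z)$ with $n\ge2$, $\det M\ne0$ and $M_{n,1}=\max_{i,k}|M_{i,k}|$. 1. Let $r$ be the least prime not dividing $M_{n,1}\det M$, and let $W=x\,\mathrm{adj}\,M+r\,\mathrm{Id}$, with entries in $\mathbb Z[x]$. 2. For $i=2,\dots,n$: add $r$ to $W_{i,1}$; then add $r^{j_i}$ to $W_{i,i-1}$, where $j_i>0$ is minimal such that afterwards $\det C\big((\mathrm{adj}\,\check W_i)_{i,1},(\mathrm{adj}\,\check W_i)_{i,2}\big)\neq0$, $\check W_i$ being the top left $i\times i$ block of $W$. 3. Let $c=\det C\big((\mathrm{adj}\,W)_{n,1},(\mathrm{adj}\,W)_{n,2}\big)$. Replace $c$ by $r+1$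 if $|c|$ is a power of $r$, and otherwise divide $c$ by the largest power of $r$ that divides it. 4. Let $j=\lceil\log_{|c|}a^2(2M_{n,1}n)^{3n}\rceil$ and $M'=W(c^j)\in M_n(\mathbb Z)$; let $A=W(0)$ be the matrix of the constants that were added, so that $M'=c^j\,\mathrm{adj}\,M+A$. 5. Choose integers $b_1,b_2$ with $|b_1|$ minimal such that $b_1(\mathrm{adj}\,M')_{n,1}+b_2(\mathrm{adj}\,M')_{n,2}=1$; let $\mathbf b=(b_1,b_2,0,\dots,0)$ and $\mathbf x=M'^{-1}\mathbf b$. 6. Obtain $q_0$ from one oracle call: either $\mathrm{SAP}(\alpha,\mathbf x)$, or $\mathrm{GDA}(\alpha/n^{1/p},\mathbf x,N)$ with $N=n^{1/p}|\det M'|/2\alpha$. Return $M'\{q_0\mathbf x\}$. Theorem. Let $p\in\{1,2,\infty\}$ define the norm. For every input as above all steps preceding the oracle call can be carried out, and however they are carried out the following hold. (i) $\det M'\neq0$ and $MM'=c^j\det M\,\mathrm{Id}+MA$. This matrix is nearly scaled orthonormal: there is $\varepsilon\in[0,1)$ with $\|MA\|_{\mathrm{op}}\le\varepsilon\,|c^j\det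 M|$ and $$\frac{1+\varepsilon}{1-\varepsilon}\le\frac{\sqrt{a^2n|\det M|^{2/n}+1}}{a\sqrt n\,|\det M|^{1/n}}.$$ The columns of $MM'$ together with $M\mathbf b$ generate the same lattice as the columns of $M$. (ii) The problem $\mathrm{SAP}(\alpha,\mathbf x)$ has a solution. With any correct $\mathrm{SAP}$ oracle, the algorithm makes exactly one call, $\mathrm{SAP}(\alpha,\mathbf x)$, and returns a vector in $\mathbb Z^n$ that solves the short vector problem given by $\alpha$ and $M$. (iii) $N\ge1$. If $\alpha\ge n^{1/p}$ (so that the call is admissible), then with any correct $\mathrm{GDA}$ oracle the algorithm makes exactly one call, $\mathrm{GDA}(\alpha/n^{1/p},\mathbf x,N)$, and returns a vector in $\mathbb Z^n$ that solves the short vector problem given by $\alpha$ and $M$. -/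

import Mathlib

open scoped ENNReal Polynomial

namespace SVPReduction

/-! ### Norms and fractional parts -/

/-- The `ℓ_s`-norm on `ℝⁿ`. -/
noncomputable def lpNorm (s : ℝ≥0∞) {n : ℕ} (v : Fin n → ℝ) : ℝ :=
  ‖(WithLp.toLp s v : PiLp s fun _ : Fin n => ℝ)‖

/-- The representative of `x` modulo `1` that lies in `(-1/2, 1/2]`. -/
def fracPart (x : ℚ) : ℚ := x - ⌈x - 1 / 2⌉

/-- The vector `{q x}`, the coordinatewise fractional part of `q x`. -/
def fracVec {n : ℕ} (q : ℤ) (x : Fin n → ℚ) : Fin n → ℚ := fun i => fracPart (q * x i)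

/-- `‖{q x}‖` for the `ℓ_s`-norm. -/
noncomputable def fracNorm (s : ℝ≥0∞) {n : ℕ} (q : ℤ) (x : Fin n → ℚ) : ℝ :=
  lpNorm s fun i => ((fracVec q x i : ℚ) : ℝ)

/-- `‖M q‖` for the `ℓ_s`-norm. -/
noncomputable def latNorm (s : ℝ≥0∞) {n : ℕ} (M : Matrix (Fin n) (Fin n) ℤ)
    (q : Fin n → ℤ) : ℝ :=
  lpNorm s fun i => ((M.mulVec q i : ℤ) : ℝ)

/-- The integers `{1, …, ⌊x⌋}`. -/
def bracket (x : ℝ) : Set ℤ := Set.Icc 1 ⌊x⌋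

/-! ### The three problems

A bound by `α` times a minimum is stated as a bound by `α` times each of the competing values. -/

/-- `q₀` solves the short vector problem with gap `α` and matrix `M`. -/
def IsSVPSolution (s : ℝ≥0∞) {n : ℕ} (α : ℝ) (M : Matrix (Fin n) (Fin n) ℤ)
    (q₀ : Fin n → ℤ) : Prop :=
  0 < latNorm s M q₀ ∧
    ∀ q : Fin n → ℤ, 0 < latNorm s M q → latNorm s M q₀ ≤ α * latNorm s M q

/-- Input of a simultaneous approximation problem. -/
structure SAPInput (n : ℕ) where
  gap : ℝ
  x : Fin n → ℚ

/-- `q₀` is a valid output for the simultaneous approximation problem `I`. -/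
def IsSAPSolution (s : ℝ≥0∞) {n : ℕ} (I : SAPInput n) (q₀ : ℤ) : Prop :=
  0 < fracNorm s q₀ I.x ∧
    ∀ q : ℤ, 0 < fracNorm s q I.x → fracNorm s q₀ I.x ≤ I.gap * fracNorm s q I.x

/-- Input of a good Diophantine approximation problem. -/
structure GDAInput (n : ℕ) where
  gap : ℝ
  x : Fin n → ℚ
  bound : ℝ

/-- `q₀` is a valid output for the good Diophantine approximation problem `I`. -/
def IsGDASolution (s : ℝ≥0∞) {n : ℕ} (I : GDAInput n) (q₀ : ℤ) : Prop :=
  q₀ ∈ bracket (I.gap * I.bound) ∧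
    ∀ q ∈ bracket I.bound, fracNorm s q₀ I.x ≤ I.gap * fracNorm s q I.x

/-- `O` answers correctly every simultaneous approximation problem that has a valid output
(there is none exactly when `x` is an integer vector). -/
def IsSAPOracle (s : ℝ≥0∞) {n : ℕ} (O : SAPInput n → ℤ) : Prop :=
  ∀ I : SAPInput n, 1 ≤ I.gap → (∃ q, IsSAPSolution s I q) → IsSAPSolution s I (O I)

/-- `O` answers correctly every good Diophantine approximation problem. -/
def IsGDAOracle (s : ℝ≥0∞) {n : ℕ} (O : GDAInput n → ℤ) : Prop :=
  ∀ I : GDAInput n, 1 ≤ I.gap → 1 ≤ I.bound → IsGDASolution s I (O I)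

/-! ### Programs with access to an oracle -/

/-- A program that may query an integer-valued oracle on inputs of type `Q`. -/
inductive OracleProgram (Q R : Type) : Type
  | done (r : R) : OracleProgram Q R
  | call (q : Q) (k : ℤ → OracleProgram Q R) : OracleProgram Q R

namespace OracleProgram

/-- The value returned when queries are answered by `O`. -/
def output {Q R : Type} (O : Q → ℤ) : OracleProgram Q R → R
  | done r => r
  | call q k => output O (k (O q))

/-- The list of queries made when queries are answered by `O`. -/
def queries {Q R : Type} (O : Q → ℤ) : OracleProgram Q R → List Q
  | done _ => []
  | call q k => q :: queries O (k (O q))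

end OracleProgram

/-! ### Ingredients of the algorithm -/

/-- The `2d × 2d` coefficient matrix of `f₁` and `f₂`, where `d` is the larger of the degrees: the
first `d` columns are the downward shifts of the coefficients of `f₁`, the last `d` columns those
of `f₂`, highest coefficient first. -/
def coeffMatrix (f₁ f₂ : ℤ[X]) (d : ℕ) : Matrix (Fin (d + d)) (Fin (d + d)) ℤ :=
  Matrix.of fun r s => s.addCases
    (fun k : Fin d => if (r : ℕ) ≤ d + k then f₁.coeff (d + k - r) else 0)
    (fun k : Fin d => if (r : ℕ) ≤ d + k then f₂.coeff (d + k - r) else 0)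

/-- The determinant of the coefficient matrix. -/
noncomputable def detC (f₁ f₂ : ℤ[X]) : ℤ :=
  (coeffMatrix f₁ f₂ (max f₁.natDegree f₂.natDegree)).det

/-- The bottom left entry of a matrix. -/
def bottomLeft {n : ℕ} (hn : 2 ≤ n) (M : Matrix (Fin n) (Fin n) ℤ) : ℤ :=
  M ⟨n - 1, by omega⟩ ⟨0, by omega⟩

/-- The top left `i × i` block. -/
def topLeft {R : Type} {n : ℕ} (W : Matrix (Fin n) (Fin n) R) (i : ℕ) (hi : i ≤ n) :
    Matrix (Fin i) (Fin i) R :=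
  W.submatrix (Fin.castLE hi) (Fin.castLE hi)

/-- The first entry of the last row of the adjugate. -/
def adjLast₁ {R : Type} [CommRing R] {n : ℕ} (hn : 2 ≤ n) (W : Matrix (Fin n) (Fin n) R) : R :=
  W.adjugate ⟨n - 1, by omega⟩ ⟨0, by omega⟩

/-- The second entry of the last row of the adjugate. -/
def adjLast₂ {R : Type} [CommRing R] {n : ℕ} (hn : 2 ≤ n) (W : Matrix (Fin n) (Fin n) R) : R :=
  W.adjugate ⟨n - 1, by omega⟩ ⟨1, by omega⟩

/-- `x adj M + p Id`, with linear polynomial entries. -/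
noncomputable def initialMatrix {n : ℕ} (M : Matrix (Fin n) (Fin n) ℤ) (p : ℕ) :
    Matrix (Fin n) (Fin n) ℤ[X] :=
  (Polynomial.X : ℤ[X]) • M.adjugate.map Polynomial.C + (p : ℤ[X]) • 1

/-- One pass through the loop, for the row `i` (rows and columns counted from `1`): add `p` to the
entry `(i, 1)`, then `p ^ e` to the entry `(i, i - 1)`. -/
noncomputable def loopStep {n : ℕ} (p i e : ℕ) (W : Matrix (Fin n) (Fin n) ℤ[X]) :
    Matrix (Fin n) (Fin n) ℤ[X] :=
  Matrix.of fun r s => W r s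
    + (if (r : ℕ) + 1 = i ∧ (s : ℕ) = 0 then (p : ℤ[X]) else 0)
    + (if (r : ℕ) + 1 = i ∧ (s : ℕ) + 2 = i then (p : ℤ[X]) ^ e else 0)

/-- The polynomial matrix after the first `k` passes `i = 2, …, k + 1` through the loop, where the
exponent used in pass `i` is `j i`. -/
noncomputable def loopMatrix {n : ℕ} (M : Matrix (Fin n) (Fin n) ℤ) (p : ℕ) (j : ℕ → ℕ) :
    ℕ → Matrix (Fin n) (Fin n) ℤ[X]
  | 0 => initialMatrix M p
  | k + 1 => loopStep p (k + 2) (j (k + 2)) (loopMatrix M p j k)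

/-- The polynomial matrix at the end of the loop. -/
noncomputable def finalMatrix {n : ℕ} (M : Matrix (Fin n) (Fin n) ℤ) (p : ℕ) (j : ℕ → ℕ) :
    Matrix (Fin n) (Fin n) ℤ[X] :=
  loopMatrix M p j (n - 1)

/-- The part of `c` prime to `p`, or `p + 1` if `|c|` is a power of `p`. -/
def coprimePart (p : ℕ) (c : ℤ) : ℤ :=
  if |c| = (p : ℤ) ^ padicValInt p c then (p : ℤ) + 1 else c / (p : ℤ) ^ padicValInt p c

/-- The base `c` of the integer that is substituted for the variable. -/
noncomputable def base {n : ℕ} (hn : 2 ≤ n) (M : Matrix (Fin n) (Fin n) ℤ) (p : ℕ)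
    (j : ℕ → ℕ) : ℤ :=
  coprimePart p (detC (adjLast₁ hn (finalMatrix M p j)) (adjLast₂ hn (finalMatrix M p j)))

/-- The integer `c ^ ⌈log_|c| (a² (2 M_{n,1} n)^{3n})⌉` that is substituted for the variable. -/
noncomputable def substValue {n : ℕ} (hn : 2 ≤ n) (a : ℕ) (M : Matrix (Fin n) (Fin n) ℤ) (p : ℕ)
    (j : ℕ → ℕ) : ℤ :=
  base hn M p j ^
    ⌈Real.logb |(base hn M p j : ℝ)| ((a : ℝ) ^ 2 * (2 * (bottomLeft hn M : ℝ) * n) ^ (3 * n))⌉₊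

/-- The integer matrix obtained from the polynomial matrix by the substitution. -/
noncomputable def newMatrix {n : ℕ} (hn : 2 ≤ n) (a : ℕ) (M : Matrix (Fin n) (Fin n) ℤ) (p : ℕ)
    (j : ℕ → ℕ) : Matrix (Fin n) (Fin n) ℤ :=
  (finalMatrix M p j).map (Polynomial.eval (substValue hn a M p j))

/-! ### The algorithm -/

/-- An execution of the part of the algorithm that precedes the oracle call, on an input with
numerator `a` and matrix `M`: the values chosen and the rules they are chosen by. -/
structure Execution {n : ℕ} (hn : 2 ≤ n) (a : ℕ) (M : Matrix (Fin n) (Fin n) ℤ) where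
  p : ℕ
  p_least : IsLeast {q : ℕ | q.Prime ∧ ¬ (q : ℤ) ∣ bottomLeft hn M * M.det} p
  /-- the exponents `j i` for `i = 2, …, n`; other values are not used -/
  j : ℕ → ℕ
  j_least : ∀ (k : ℕ) (hk : k + 2 ≤ n), IsLeast
    {e : ℕ | 0 < e ∧
      detC (adjLast₁ (by omega) (topLeft (loopStep p (k + 2) e (loopMatrix M p j k)) (k + 2) hk))
        (adjLast₂ (by omega) (topLeft (loopStep p (k + 2) e (loopMatrix M p j k)) (k + 2) hk)) ≠ 0}
    (j (k + 2))
  b₁ : ℤ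
  b₂ : ℤ
  bezout : b₁ * adjLast₁ hn (newMatrix hn a M p j) + b₂ * adjLast₂ hn (newMatrix hn a M p j) = 1
  b₁_minimal : ∀ u v : ℤ,
    u * adjLast₁ hn (newMatrix hn a M p j) + v * adjLast₂ hn (newMatrix hn a M p j) = 1 → |b₁| ≤ |u|

namespace Execution

variable {n : ℕ} {hn : 2 ≤ n} {a : ℕ} {M : Matrix (Fin n) (Fin n) ℤ} (E : Execution hn a M)

/-- The integer substituted for the variable. -/
noncomputable def t : ℤ := substValue hn a M E.p E.j

/-- The integer matrix obtained by the substitution. -/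
noncomputable def M' : Matrix (Fin n) (Fin n) ℤ := newMatrix hn a M E.p E.j

/-- The matrix of the constants added: the constant terms of the polynomial matrix. -/
noncomputable def A : Matrix (Fin n) (Fin n) ℤ :=
  (finalMatrix M E.p E.j).map (Polynomial.eval 0)

/-- The vector `(b₁, b₂, 0, …, 0)`. -/
def b : Fin n → ℤ := fun i => if (i : ℕ) = 0 then E.b₁ else if (i : ℕ) = 1 then E.b₂ else 0

/-- The vector `M'⁻¹ b`. -/
noncomputable def x : Fin n → ℚ :=
  (E.M'.map (Int.cast : ℤ → ℚ))⁻¹.mulVec fun i => (E.b i : ℚ)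

/-- The vector `M' {q₀ x}` returned for the oracle answer `q₀`. -/
noncomputable def result (q₀ : ℤ) : Fin n → ℚ :=
  (E.M'.map (Int.cast : ℤ → ℚ)).mulVec (fracVec q₀ E.x)

/-- The input of the call to the simultaneous approximation oracle. -/
noncomputable def sapInput (α : ℝ) : SAPInput n := ⟨α, E.x⟩

/-- The input of the call to the good Diophantine approximation oracle. -/
noncomputable def gdaInput (s : ℝ≥0∞) (α : ℝ) : GDAInput n :=
  ⟨α / (n : ℝ) ^ (s⁻¹).toReal, E.x, (n : ℝ) ^ (s⁻¹).toReal * |(E.M'.det : ℝ)| / (2 * α)⟩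

/-- The algorithm with the simultaneous approximation oracle. -/
noncomputable def sapProgram (α : ℝ) : OracleProgram (SAPInput n) (Fin n → ℚ) :=
  .call (E.sapInput α) fun q₀ => .done (E.result q₀)

/-- The algorithm with the good Diophantine approximation oracle. -/
noncomputable def gdaProgram (s : ℝ≥0∞) (α : ℝ) : OracleProgram (GDAInput n) (Fin n → ℚ) :=
  .call (E.gdaInput s α) fun q₀ => .done (E.result q₀)

end Execution

/-- `w Id + B` is nearly scaled orthonormal for the `ℓ_s`-norm, relative to `a` and `D`: for some
`ε < 1` the operator norm of `B` is at most `ε |w|`, and multiplication by `w Id + B`, which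
distorts ratios of norms by at most `(1 + ε) / (1 - ε)`, distorts them by at most
`√(a² n D^{2/n} + 1) / (a √n D^{1/n})`. -/
def IsNearlyScaledOrthonormal (s : ℝ≥0∞) {n : ℕ} (a : ℕ) (D : ℝ) (w : ℤ)
    (B : Matrix (Fin n) (Fin n) ℤ) : Prop :=
  ∃ ε : ℝ, 0 ≤ ε ∧ ε < 1 ∧
    (∀ u : Fin n → ℝ,
      lpNorm s ((B.map (Int.cast : ℤ → ℝ)).mulVec u) ≤ ε * |(w : ℝ)| * lpNorm s u) ∧
    (1 + ε) / (1 - ε) ≤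
      √((a : ℝ) ^ 2 * n * D ^ (2 / (n : ℝ)) + 1) / (a * √(n : ℝ) * D ^ (1 / (n : ℝ)))

end SVPReduction

/-!
The determinant `det C(f₁, f₂)` is the resultant of `f₁` and `f₂` for their larger degree as formal
degree of both, so (unless `f₁ = f₂ = 0`) it is nonzero exactly if `f₁` and `f₂` are coprime over
`ℚ` (`detC_ne_zero`, `ratCoprime_of_detC_ne_zero`).

**The loop.** Up to sign, the two polynomials in the test for the block of size `i` are minors.
They have the form `g + p ^ e h`, where `h` is the corresponding minor of the previous block
(`lastMinor_add_corner`). The pair of the `h` is coprime by induction, and `h₂ g₁ - h₁ g₂` is not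
zero, since its constant term can be read off the constants that have been added
(`lastMinor_one_constMatrix`, `lastMinor_zero_constMatrix`). So an exponent is bad only if `p ^ e`
belongs to one of the roots of `h₂ g₁ - h₁ g₂`, and the exponent found is at most twice the degree
of the minors (`exists_exponent`, `loopInvariant_of_isLeast`). At the end the constant term of the
second polynomial is a power of `p` up to sign. With the substituted value `t` prime to `p` and
divisible by all other primes in the final determinant, this makes the two entries of `adj M'`
coprime (`isCoprime_newMatrix`), and all steps can be carried out (`nonempty_execution`).

**The estimates.** By Chebyshev's bound the prime `p` is at most `(2 m n) ^ (3 / 2)`, where `m` is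
the largest entry of `M` (`sq_least_prime_le`). Together with the bound on the exponents this makes
`M A` so small against `t det M` that `M M' = t det M + M A` distorts norms by less than the
discreteness of the norms of integer vectors can detect (`Execution.lpNorm_mul_A_le`,
`mul_lpNorm_le_of_sq_lt`).

**The reduction.** As `adj M' b` ends in `1`, the order of `b` modulo the lattice of `M'` is
`|det M'|`, and every integer vector is an integer combination of `b` and the columns of `M'`
(`exists_eq_smul_add_mulVec`). So every integer vector `v` for which `M'⁻¹ v` has small coordinates
is `M' {q x}` for some `q`. By Minkowski's theorem (`exists_mulVec_le`) these include all vectors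
that matter for the short vector problem, and a good `{q₀ x}` gives a short vector
(`isSVPSolution_latticeVec`). For the second oracle it is used in addition that the last coordinate
of `x` is `1 / det M'`, so that `q` can be recovered from `{q x}` (`exists_small_multiple`).
-/

namespace SVPReduction

open Polynomial

/-! ### The determinant of the coefficient matrix -/

theorem detC_eq_resultant (f g : ℤ[X]) :
    detC f g = resultant f g (max f.natDegree g.natDegree) (max f.natDegree g.natDegree) := by
  unfold detC resultant
  set d := max f.natDegree g.natDegree
  have hf : f.natDegree ≤ d := le_max_left _ _
  have hg : g.natDegree ≤ d := le_max_right _ _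
  rw [← Matrix.det_submatrix_equiv_self Fin.revPerm (sylvester f g d d)]
  congr 1
  ext r s
  simp only [coeffMatrix, Matrix.of_apply, Matrix.submatrix_apply, sylvester, Fin.revPerm_apply]
  induction s using Fin.addCases with
  | left k =>
    have : Fin.rev (Fin.castAdd d k) = Fin.natAdd d (Fin.rev k) := by
      ext; simp only [Fin.val_rev, Fin.val_natAdd, Fin.val_castAdd]; omega
    rw [this, Fin.addCases_left, Fin.addCases_right]
    simp only [Fin.val_rev, Set.mem_Icc]
    by_cases h : (r : ℕ) ≤ d + k
    · rw [if_pos h]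
      by_cases h2 : (k : ℕ) ≤ r
      · rw [if_pos (by omega)]; congr 1; omega
      · rw [if_neg (by omega), coeff_eq_zero_of_natDegree_lt (by omega)]
    · rw [if_neg h, if_neg (by omega)]
  | right k =>
    have : Fin.rev (Fin.natAdd d k) = Fin.castAdd d (Fin.rev k) := by
      ext; simp only [Fin.val_rev, Fin.val_natAdd, Fin.val_castAdd]; omega
    rw [this, Fin.addCases_left, Fin.addCases_right]
    simp only [Fin.val_rev, Set.mem_Icc]
    by_cases h : (r : ℕ) ≤ d + k
    · rw [if_pos h]
      by_cases h2 : (k : ℕ) ≤ r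
      · rw [if_pos (by omega)]; congr 1; omega
      · rw [if_neg (by omega), coeff_eq_zero_of_natDegree_lt (by omega)]
    · rw [if_neg h, if_neg (by omega)]

/-- In positive degree the determinant lies in the ideal generated by the two polynomials. In degree
`0` this can fail, since the determinant is then `1`. -/
theorem exists_mul_add_mul_eq_C_detC (f g : ℤ[X]) (h : f.natDegree ≠ 0 ∨ g.natDegree ≠ 0) :
    ∃ u v, f * u + g * v = C (detC f g) := by
  obtain ⟨u, v, -, -, e⟩ := exists_mul_add_mul_eq_C_resultant
    (m := max f.natDegree g.natDegree) (n := max f.natDegree g.natDegree) f g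
    (le_max_left _ _) (le_max_right _ _) (by omega)
  exact ⟨u, v, by rw [e, detC_eq_resultant]⟩

theorem resultant_ne_zero_of_natDegree_le {K : Type*} [Field K] {f g : K[X]} {d : ℕ}
    (hf : f.natDegree = d) (hg : g.natDegree ≤ d) (h : IsCoprime f g) :
    resultant f g d d ≠ 0 := by
  obtain rfl | hf0 := eq_or_ne f 0
  · obtain rfl : d = 0 := by simpa using hf.symm
    have : resultant (0 : K[X]) g 0 0 = 1 := by simp
    rw [this]; exact one_ne_zero
  obtain ⟨k, rfl⟩ := Nat.exists_eq_add_of_le hg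
  rw [resultant_add_right_deg _ _ _ _ _ le_rfl]
  refine mul_ne_zero (pow_ne_zero _ ?_) ?_
  · rw [← hf]; simpa using hf0
  · rw [← hf]; exact resultant_ne_zero f g h

/-- Two integer polynomials without a common factor over `ℚ`. -/
def RatCoprime (f g : ℤ[X]) : Prop :=
  IsCoprime (f.map (Int.castRingHom ℚ)) (g.map (Int.castRingHom ℚ))

theorem detC_ne_zero {f g : ℤ[X]} (h : RatCoprime f g) : detC f g ≠ 0 := by
  have hf := natDegree_map_eq_of_injective (f := Int.castRingHom ℚ) Int.cast_injective f
  have hg := natDegree_map_eq_of_injective (f := Int.castRingHom ℚ) Int.cast_injective g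
  intro h0
  rw [detC_eq_resultant] at h0
  have key := resultant_map_map f g (max f.natDegree g.natDegree) (max f.natDegree g.natDegree)
    (Int.castRingHom ℚ)
  rw [h0, map_zero] at key
  rcases le_total g.natDegree f.natDegree with hd | hd
  · rw [max_eq_left hd] at key
    exact resultant_ne_zero_of_natDegree_le hf (hg.trans_le hd) h key
  · rw [max_eq_right hd, resultant_comm] at key
    refine resultant_ne_zero_of_natDegree_le hg (hf.trans_le hd) h.symm ?_
    simpa using key

/-- In degree `0` the determinant is `1` for the zero pair too, whence the assumption on `g`. -/
theorem ratCoprime_of_detC_ne_zero {f g : ℤ[X]} (hg : g ≠ 0) (h : detC f g ≠ 0) :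
    RatCoprime f g := by
  unfold RatCoprime
  by_cases hd : f.natDegree ≠ 0 ∨ g.natDegree ≠ 0
  · obtain ⟨u, v, e⟩ := exists_mul_add_mul_eq_C_detC f g hd
    have e' := congrArg (Polynomial.map (Int.castRingHom ℚ)) e
    simp only [Polynomial.map_add, Polynomial.map_mul, Polynomial.map_C] at e'
    have hunit : IsUnit (C ((Int.castRingHom ℚ) (detC f g))) := by
      rw [isUnit_C]; exact (Int.cast_ne_zero.mpr h).isUnit
    obtain ⟨w, hw⟩ := hunit.exists_left_inv
    refine ⟨w * u.map (Int.castRingHom ℚ), w * v.map (Int.castRingHom ℚ), ?_⟩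
    rw [← hw, ← e']; ring
  · have hg0 : g.natDegree = 0 := by omega
    obtain ⟨c, rfl⟩ := natDegree_eq_zero.mp hg0
    have hc : (c : ℚ) ≠ 0 := by
      rintro h'; apply hg; simp [Int.cast_eq_zero.mp h']
    have hu : IsUnit ((C c).map (Int.castRingHom ℚ)) := by
      rw [map_C, isUnit_C]; exact hc.isUnit
    obtain ⟨w, hw⟩ := hu.exists_left_inv
    exact ⟨0, w, by rw [zero_mul, zero_add, hw]⟩

theorem ratCoprime_iff {f g : ℤ[X]} :
    RatCoprime f g ↔ ∀ z : ℂ, aeval z f ≠ 0 ∨ aeval z g ≠ 0 := by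
  have hev : ∀ (f : ℤ[X]) (z : ℂ), aeval z (f.map (Int.castRingHom ℚ)) = aeval z f :=
    fun f z => aeval_map_algebraMap ℚ z f
  have h := Polynomial.isCoprime_iff_aeval_ne_zero_of_isAlgClosed ℚ ℂ
    (f.map (Int.castRingHom ℚ)) (g.map (Int.castRingHom ℚ))
  simp only [hev] at h
  exact h

/-! ### The choice of an exponent -/

/-- If `g₁ + t h₁` and `g₂ + t h₂` have a common root, it is a root of `h₂ g₁ - h₁ g₂`, which does
not depend on `t`, and it determines `t`. So there are at most `deg (h₂ g₁ - h₁ g₂)` values of `t`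
for which the two polynomials are not coprime. -/
theorem exists_exponent {p δ : ℕ} (hp : 2 ≤ p) {g₁ g₂ h₁ h₂ : ℤ[X]} (hh : RatCoprime h₁ h₂)
    (h0 : h₂ * g₁ - h₁ * g₂ ≠ 0) (hδ : (h₂ * g₁ - h₁ * g₂).natDegree ≤ δ) :
    ∃ e, 0 < e ∧ e ≤ δ + 1 ∧
      RatCoprime (g₁ + (p : ℤ[X]) ^ e * h₁) (g₂ + (p : ℤ[X]) ^ e * h₂) := by
  by_contra! hcon
  have root : ∀ e : Fin (δ + 1), ∃ z : ℂ,
      aeval z (g₁ + (p : ℤ[X]) ^ (e + 1 : ℕ) * h₁) = 0 ∧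
      aeval z (g₂ + (p : ℤ[X]) ^ (e + 1 : ℕ) * h₂) = 0 := by
    intro e
    have := hcon (e + 1) (by omega) (by omega)
    rw [ratCoprime_iff] at this
    push Not at this
    exact this
  choose z hz₁ hz₂ using root
  simp only [map_add, map_mul, map_pow, map_natCast] at hz₁ hz₂
  set Δ := h₂ * g₁ - h₁ * g₂ with hΔ
  have hinj : Function.Injective z := by
    intro e e' he
    by_contra hne
    have hpow : ((p : ℂ) ^ (e + 1 : ℕ) - (p : ℂ) ^ (e' + 1 : ℕ)) ≠ 0 := by
      rw [sub_ne_zero]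
      intro h
      have h' : p ^ (e + 1 : ℕ) = p ^ (e' + 1 : ℕ) := by exact_mod_cast h
      have := Nat.pow_right_injective hp h'
      exact hne (Fin.ext (by simpa using this))
    have a₁ := hz₁ e
    have a₂ := hz₂ e
    rw [he] at a₁ a₂
    have b₁ : aeval (z e') h₁ = 0 := by
      apply (mul_eq_zero.mp _).resolve_left hpow
      linear_combination a₁ - hz₁ e'
    have b₂ : aeval (z e') h₂ = 0 := by
      apply (mul_eq_zero.mp _).resolve_left hpow
      linear_combination a₂ - hz₂ e'
    have := ratCoprime_iff.mp hh (z e')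
    tauto
  have hroot : ∀ e, aeval (z e) Δ = 0 := by
    intro e
    simp only [hΔ, map_sub, map_mul]
    linear_combination aeval (z e) h₂ * hz₁ e - aeval (z e) h₁ * hz₂ e
  have hne : Δ.map (algebraMap ℤ ℂ) ≠ 0 := by
    rwa [Ne, Polynomial.map_eq_zero_iff (by exact Int.cast_injective)]
  have hsub : Finset.univ.image z ⊆ (Δ.map (algebraMap ℤ ℂ)).roots.toFinset := by
    intro y hy
    obtain ⟨e, -, rfl⟩ := Finset.mem_image.mp hy
    rw [Multiset.mem_toFinset, mem_roots hne, IsRoot, eval_map_algebraMap]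
    exact hroot e
  have hcard := Finset.card_le_card hsub
  rw [Finset.card_image_of_injective _ hinj, Finset.card_univ, Fintype.card_fin] at hcard
  have h3 : (Δ.map (algebraMap ℤ ℂ)).roots.toFinset.card ≤ δ :=
    (Multiset.toFinset_card_le _).trans (((card_roots' _).trans natDegree_map_le).trans hδ)
  omega

/-! ### Minors for the last row of the adjugate -/

/-- The minor without the row `r` and the last column. Up to sign it is the `r`-th entry of the
last row of the adjugate. -/
def lastMinor {R : Type} [CommRing R] {m : ℕ} (r : Fin (m + 1))
    (V : Matrix (Fin (m + 1)) (Fin (m + 1)) R) : R :=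
  (V.submatrix r.succAbove Fin.castSucc).det

theorem adjLast₁_eq {R : Type} [CommRing R] {k : ℕ} (h : 2 ≤ k + 2)
    (V : Matrix (Fin (k + 2)) (Fin (k + 2)) R) :
    adjLast₁ h V = (-1) ^ (k + 1) * lastMinor 0 V := by
  have : (⟨k + 2 - 1, by omega⟩ : Fin (k + 2)) = Fin.last (k + 1) := rfl
  rw [adjLast₁, this, Matrix.adjugate_fin_succ_eq_det_submatrix, lastMinor, Fin.succAbove_last]
  simp

theorem adjLast₂_eq {R : Type} [CommRing R] {k : ℕ} (h : 2 ≤ k + 2)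
    (V : Matrix (Fin (k + 2)) (Fin (k + 2)) R) :
    adjLast₂ h V = (-1) ^ (k + 2) * lastMinor 1 V := by
  have : (⟨k + 2 - 1, by omega⟩ : Fin (k + 2)) = Fin.last (k + 1) := rfl
  have h1 : (⟨1, by omega⟩ : Fin (k + 2)) = 1 := rfl
  rw [adjLast₂, this, h1, Matrix.adjugate_fin_succ_eq_det_submatrix, lastMinor, Fin.succAbove_last]
  congr 2
  simp; ring

theorem map_lastMinor {R S : Type} [CommRing R] [CommRing S] (φ : R →+* S) {m : ℕ}
    (r : Fin (m + 1)) (V : Matrix (Fin (m + 1)) (Fin (m + 1)) R) :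
    φ (lastMinor r V) = lastMinor r (V.map φ) := by
  rw [lastMinor, RingHom.map_det]; rfl

/-- Adding `t` to the entry left of the bottom right corner changes the minors linearly; the
coefficient of `t` is the corresponding minor of the matrix without last row and last column. -/
theorem lastMinor_add_corner {R : Type} [CommRing R] {k : ℕ} (r : Fin (k + 1)) (t : R)
    (V V' : Matrix (Fin (k + 2)) (Fin (k + 2)) R)
    (h : ∀ i l, V' i l =
      V i l + if i = Fin.last (k + 1) ∧ l = (Fin.last k).castSucc then t else 0) :
    lastMinor r.castSucc V' = lastMinor r.castSucc V +
      t * lastMinor r (V.submatrix Fin.castSucc Fin.castSucc) := by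
  have hlast : r.castSucc.succAbove (Fin.last k) = Fin.last (k + 1) := by
    rw [Fin.succAbove_of_le_castSucc]
    · simp
    · simpa using Fin.le_last r
  have hcast : ∀ i : Fin k, r.castSucc.succAbove i.castSucc = (r.succAbove i).castSucc :=
    fun i => (Fin.castSucc_succAbove_castSucc).symm ▸ rfl
  have hrow : ∀ (W : Matrix (Fin (k + 2)) (Fin (k + 2)) R) (l : Fin (k + 1)),
      ((W.submatrix r.castSucc.succAbove Fin.castSucc).submatrix (Fin.last k).succAbove
        l.succAbove) = fun i l' => W (r.succAbove i).castSucc (l.succAbove l').castSucc := by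
    intro W l
    ext i l'
    simp only [Matrix.submatrix_apply, Fin.succAbove_last]
    rw [hcast]
  have hsub : ∀ l : Fin (k + 1),
      (V'.submatrix r.castSucc.succAbove Fin.castSucc).submatrix (Fin.last k).succAbove l.succAbove =
      (V.submatrix r.castSucc.succAbove Fin.castSucc).submatrix
        (Fin.last k).succAbove l.succAbove := by
    intro l
    rw [hrow, hrow]
    ext i l'
    rw [h, if_neg, add_zero]
    rintro ⟨h1, -⟩
    exact absurd h1 (Fin.castSucc_lt_last _).ne
  rw [lastMinor, lastMinor, Matrix.det_succ_row _ (Fin.last k),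
    Matrix.det_succ_row (V.submatrix r.castSucc.succAbove Fin.castSucc) (Fin.last k),
    Fin.sum_univ_castSucc, Fin.sum_univ_castSucc]
  simp only [hsub]
  simp only [Matrix.submatrix_apply, hlast, h]
  have e1 : ∀ i : Fin k, (i.castSucc.castSucc = (Fin.last k).castSucc) = False := by
    intro i
    simp only [eq_iff_iff, iff_false]
    intro hh
    exact absurd (Fin.castSucc_injective _ hh) (Fin.castSucc_lt_last i).ne
  simp only [e1, and_false, if_false, add_zero, and_self, if_true]
  have e2 : (V.submatrix r.castSucc.succAbove Fin.castSucc).submatrix (Fin.last k).succAbove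
      (Fin.last k).succAbove =
      (V.submatrix Fin.castSucc Fin.castSucc).submatrix r.succAbove Fin.castSucc := by
    rw [hrow]
    ext i l'
    simp
  rw [lastMinor, e2]
  have e3 : ((-1 : R)) ^ ((Fin.last k : ℕ) + (Fin.last k : ℕ)) = 1 :=
    Even.neg_one_pow ⟨_, rfl⟩
  rw [e3]; ring

/-! ### The shape of the matrices in the loop -/

/-- The constants that have been added to `x adj M` when the entries of the first column have been
treated in the rows up to `k` and those below the diagonal in the rows up to `l`; rows are counted
from `0`. -/
def constMatrix (N p k l : ℕ) (j : ℕ → ℕ) : Matrix (Fin N) (Fin N) ℤ :=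
  Matrix.of fun r s => (if (r : ℕ) = s then (p : ℤ) else 0)
    + (if 0 < (r : ℕ) ∧ (r : ℕ) ≤ k ∧ (s : ℕ) = 0 then (p : ℤ) else 0)
    + (if 0 < (r : ℕ) ∧ (r : ℕ) ≤ l ∧ (s : ℕ) + 1 = r then (p : ℤ) ^ j (r + 1) else 0)

/-- The matrix `x B + A` with linear polynomial entries. -/
noncomputable def pencil {N : ℕ} (B A : Matrix (Fin N) (Fin N) ℤ) :
    Matrix (Fin N) (Fin N) ℤ[X] :=
  (X : ℤ[X]) • B.map C + A.map C

theorem map_eval_pencil {N : ℕ} (B A : Matrix (Fin N) (Fin N) ℤ) (t : ℤ) :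
    (pencil B A).map (evalRingHom t) = t • B + A := by
  ext r s
  simp only [pencil, Matrix.map_apply, Matrix.add_apply, Matrix.smul_apply, smul_eq_mul,
    coe_evalRingHom, eval_add, eval_mul, eval_X, eval_C]

theorem natDegree_lastMinor_pencil_le {m : ℕ} (r : Fin (m + 1))
    (B A : Matrix (Fin (m + 1)) (Fin (m + 1)) ℤ) :
    (lastMinor r (pencil B A)).natDegree ≤ m := by
  have := natDegree_det_X_add_C_le (B.submatrix r.succAbove Fin.castSucc)
    (A.submatrix r.succAbove Fin.castSucc)
  rw [Fintype.card_fin] at this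
  exact this

theorem loopMatrix_eq_pencil {n : ℕ} (M : Matrix (Fin n) (Fin n) ℤ) (p : ℕ) (j : ℕ → ℕ) (k : ℕ) :
    loopMatrix M p j k = pencil M.adjugate (constMatrix n p k k j) := by
  induction k with
  | zero =>
    ext1 r s
    simp only [loopMatrix, initialMatrix, pencil, constMatrix, Matrix.add_apply,
      Matrix.smul_apply, Matrix.map_apply, Matrix.of_apply, smul_eq_mul]
    congr 1
    have h1 : ¬ (0 < (r : ℕ) ∧ (r : ℕ) ≤ 0 ∧ (s : ℕ) = 0) := by omega
    have h2 : ¬ (0 < (r : ℕ) ∧ (r : ℕ) ≤ 0 ∧ (s : ℕ) + 1 = r) := by omega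
    rw [if_neg h1, if_neg h2, add_zero, add_zero, Matrix.one_apply]
    by_cases h : r = s
    · simp [h]
    · rw [if_neg h, if_neg (by omega)]; simp
  | succ k ih =>
    ext1 r s
    simp only [loopMatrix, loopStep, ih, pencil, constMatrix, Matrix.add_apply,
      Matrix.smul_apply, Matrix.map_apply, Matrix.of_apply, smul_eq_mul, map_add]
    have h1 : (C (if 0 < (r : ℕ) ∧ (r : ℕ) ≤ k + 1 ∧ (s : ℕ) = 0 then (p : ℤ) else 0) : ℤ[X]) =
        C (if 0 < (r : ℕ) ∧ (r : ℕ) ≤ k ∧ (s : ℕ) = 0 then (p : ℤ) else 0) +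
        (if (r : ℕ) + 1 = k + 2 ∧ (s : ℕ) = 0 then (p : ℤ[X]) else 0) := by
      by_cases h : (r : ℕ) + 1 = k + 2 ∧ (s : ℕ) = 0
      · rw [if_pos (by omega), if_neg (by omega), if_pos h]; simp
      · rw [if_neg h, add_zero]; congr 2; simp only [eq_iff_iff]; omega
    have h2 : (C (if 0 < (r : ℕ) ∧ (r : ℕ) ≤ k + 1 ∧ (s : ℕ) + 1 = r then
          (p : ℤ) ^ j (r + 1) else 0) : ℤ[X]) =
        C (if 0 < (r : ℕ) ∧ (r : ℕ) ≤ k ∧ (s : ℕ) + 1 = r then (p : ℤ) ^ j (r + 1) else 0) +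
        (if (r : ℕ) + 1 = k + 2 ∧ (s : ℕ) + 2 = k + 2 then (p : ℤ[X]) ^ j (k + 2) else 0) := by
      by_cases h : (r : ℕ) + 1 = k + 2 ∧ (s : ℕ) + 2 = k + 2
      · rw [if_pos (by omega), if_neg (by omega), if_pos h, h.1]; simp
      · rw [if_neg h, add_zero]; congr 2; simp only [eq_iff_iff]; omega
    rw [h1, h2]; ring

/-- The top left block of size `k + 2` after the pass through the loop for that block, with the
exponent `e`. -/
noncomputable def loopBlock {n : ℕ} (M : Matrix (Fin n) (Fin n) ℤ) (p : ℕ) (j : ℕ → ℕ) (k e : ℕ)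
    (hk : k + 2 ≤ n) : Matrix (Fin (k + 2)) (Fin (k + 2)) ℤ[X] :=
  topLeft (loopStep p (k + 2) e (loopMatrix M p j k)) (k + 2) hk

/-- The same block before the last of the additions. -/
noncomputable def preBlock {n : ℕ} (M : Matrix (Fin n) (Fin n) ℤ) (p : ℕ) (j : ℕ → ℕ) (k : ℕ)
    (hk : k + 2 ≤ n) : Matrix (Fin (k + 2)) (Fin (k + 2)) ℤ[X] :=
  pencil (topLeft M.adjugate (k + 2) hk) (constMatrix (k + 2) p (k + 1) k j)

theorem loopBlock_apply {n : ℕ} (M : Matrix (Fin n) (Fin n) ℤ) (p : ℕ) (j : ℕ → ℕ) (k e : ℕ)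
    (hk : k + 2 ≤ n) (r s : Fin (k + 2)) :
    loopBlock M p j k e hk r s = preBlock M p j k hk r s +
      if r = Fin.last (k + 1) ∧ s = (Fin.last k).castSucc then (p : ℤ[X]) ^ e else 0 := by
  simp only [loopBlock, preBlock, topLeft, loopMatrix_eq_pencil, loopStep, pencil, constMatrix,
    Matrix.add_apply, Matrix.smul_apply, Matrix.map_apply, Matrix.of_apply, smul_eq_mul, map_add,
    Matrix.submatrix_apply, Fin.val_castLE]
  have hr := r.isLt
  have h1 : (C (if 0 < (r : ℕ) ∧ (r : ℕ) ≤ k + 1 ∧ (s : ℕ) = 0 then (p : ℤ) else 0) : ℤ[X]) =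
      C (if 0 < (r : ℕ) ∧ (r : ℕ) ≤ k ∧ (s : ℕ) = 0 then (p : ℤ) else 0) +
      (if (r : ℕ) + 1 = k + 2 ∧ (s : ℕ) = 0 then (p : ℤ[X]) else 0) := by
    by_cases h : (r : ℕ) + 1 = k + 2 ∧ (s : ℕ) = 0
    · rw [if_pos (by omega), if_neg (by omega), if_pos h]; simp
    · rw [if_neg h, add_zero]; congr 2; simp only [eq_iff_iff]; omega
  have h2 : ((r : ℕ) + 1 = k + 2 ∧ (s : ℕ) + 2 = k + 2) ↔
      (r = Fin.last (k + 1) ∧ s = (Fin.last k).castSucc) := by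
    simp only [Fin.ext_iff, Fin.val_last, Fin.val_castSucc]; omega
  rw [h1]
  simp only [h2]
  ring

theorem preBlock_submatrix {n : ℕ} (M : Matrix (Fin n) (Fin n) ℤ) (p : ℕ) (j : ℕ → ℕ) (k : ℕ)
    (hk : k + 1 + 2 ≤ n) :
    (preBlock M p j (k + 1) hk).submatrix Fin.castSucc Fin.castSucc =
      loopBlock M p j k (j (k + 2)) (by omega) := by
  have : loopBlock M p j k (j (k + 2)) (by omega) =
      topLeft (loopMatrix M p j (k + 1)) (k + 2) (by omega) := rfl
  rw [this, loopMatrix_eq_pencil]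
  ext1 r s
  have hr := r.isLt
  simp only [preBlock, topLeft, pencil, constMatrix,
    Matrix.add_apply, Matrix.smul_apply, Matrix.map_apply, Matrix.of_apply, smul_eq_mul, map_add,
    Matrix.submatrix_apply, Fin.val_castLE, Fin.val_castSucc]
  have h3 : ((0 < (r : ℕ) ∧ (r : ℕ) ≤ k + 1 + 1 ∧ (s : ℕ) = 0)) =
    ((0 < (r : ℕ) ∧ (r : ℕ) ≤ k + 1 ∧ (s : ℕ) = 0)) := by simp only [eq_iff_iff]; omega
  simp only [h3]
  rfl

/-! ### The constant terms of the minors -/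

theorem lastMinor_one_constMatrix (p k : ℕ) (j : ℕ → ℕ) :
    lastMinor 1 (constMatrix (k + 3) p (k + 2) (k + 1) j) = 0 := by
  apply Matrix.det_zero_of_row_eq (i := 0) (j := Fin.last (k + 1))
  · exact (Fin.last_pos).ne
  · have h0 : (1 : Fin (k + 3)).succAbove 0 = 0 := rfl
    have h1 : (1 : Fin (k + 3)).succAbove (Fin.last (k + 1)) = Fin.last (k + 2) := rfl
    ext s
    have hs := s.isLt
    simp only [Matrix.submatrix_apply, h0, h1, constMatrix, Matrix.of_apply, Fin.val_castSucc,
      Fin.val_last, Fin.val_zero]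
    have h2 : ¬ (k + 2 = (s : ℕ)) := by omega
    have h3 : ¬ ((s : ℕ) + 1 = k + 2 ∧ k + 2 ≤ k + 1) := by omega
    simp [h2, eq_comm]

theorem lastMinor_zero_constMatrix {p : ℕ} (hp : p ≠ 0) (k : ℕ) (j : ℕ → ℕ) :
    lastMinor 0 (constMatrix (k + 3) p (k + 2) (k + 1) j) ≠ 0 := by
  rw [lastMinor, Matrix.det_succ_row _ (Fin.last (k + 1)), Finset.sum_eq_single 0]
  · refine mul_ne_zero (mul_ne_zero (by simp) ?_) ?_
    · simp [constMatrix, hp]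
    · rw [Matrix.det_of_isLowerTriangular]
      · refine Finset.prod_ne_zero_iff.mpr fun i _ => ?_
        have h2 := i.isLt
        simp [constMatrix, hp]
      · intro i l hil
        have hil' : (i : ℕ) < l := hil
        simp only [constMatrix, Matrix.submatrix_apply, Matrix.of_apply]
        simp
        omega
  · intro s _ hs
    have hs' : (s : ℕ) ≠ 0 := fun h => hs (Fin.ext h)
    have h2 := s.isLt
    have : (constMatrix (k + 3) p (k + 2) (k + 1) j).submatrix (Fin.succAbove 0) Fin.castSucc
        (Fin.last (k + 1)) s = 0 := by
      simp only [constMatrix, Matrix.submatrix_apply, Matrix.of_apply, Fin.val_castSucc,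
        Fin.succAbove_zero, Fin.val_succ, Fin.val_last]
      rw [if_neg (by omega), if_neg (by omega), if_neg (by omega)]; rfl
    rw [this, mul_zero, zero_mul]
  · simp

theorem eval_zero_lastMinor_preBlock {n : ℕ} (M : Matrix (Fin n) (Fin n) ℤ) (p : ℕ) (j : ℕ → ℕ)
    (k : ℕ) (hk : k + 2 ≤ n) (r : Fin (k + 2)) :
    (lastMinor r (preBlock M p j k hk)).eval 0 =
      lastMinor r (constMatrix (k + 2) p (k + 1) k j) := by
  have := map_lastMinor (evalRingHom (0 : ℤ)) r (preBlock M p j k hk)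
  rw [preBlock, map_eval_pencil, zero_smul, zero_add, coe_evalRingHom] at this
  exact this

/-! ### The loop -/

section Loop

variable {n : ℕ} (M : Matrix (Fin n) (Fin n) ℤ) (p : ℕ) (j : ℕ → ℕ)

/-- The invariant of the loop: the two minors of the current block are coprime over `ℚ`, and the
constant term of the second is a power of `p`. -/
def LoopInvariant (k e : ℕ) (hk : k + 2 ≤ n) : Prop :=
  RatCoprime (lastMinor 0 (loopBlock M p j k e hk)) (lastMinor 1 (loopBlock M p j k e hk)) ∧
    ∃ N, (lastMinor 1 (loopBlock M p j k e hk)).eval 0 = (p : ℤ) ^ N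

theorem lastMinor_zero_loopBlock_zero (e : ℕ) (hk : 0 + 2 ≤ n) :
    lastMinor 0 (loopBlock M p j 0 e hk) =
      lastMinor 0 (preBlock M p j 0 hk) + (p : ℤ[X]) ^ e * 1 := by
  have := lastMinor_add_corner 0 _ _ _ (loopBlock_apply M p j 0 e hk)
  rw [show lastMinor 0 ((preBlock M p j 0 hk).submatrix Fin.castSucc Fin.castSucc) = 1 from
    Matrix.det_fin_zero] at this
  exact this

theorem lastMinor_one_loopBlock_zero (e : ℕ) (hk : 0 + 2 ≤ n) :
    lastMinor 1 (loopBlock M p j 0 e hk) =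
      lastMinor 1 (preBlock M p j 0 hk) + (p : ℤ[X]) ^ e * 0 := by
  rw [mul_zero, add_zero, lastMinor, lastMinor]
  congr 1
  ext1 r s
  obtain rfl : r = 0 := Subsingleton.elim _ _
  rw [Matrix.submatrix_apply, Matrix.submatrix_apply, loopBlock_apply, if_neg, add_zero]
  rintro ⟨h, -⟩
  exact absurd h (by decide)

theorem lastMinor_zero_loopBlock_succ (k e : ℕ) (hk : k + 1 + 2 ≤ n) :
    lastMinor 0 (loopBlock M p j (k + 1) e hk) = lastMinor 0 (preBlock M p j (k + 1) hk) +
      (p : ℤ[X]) ^ e * lastMinor 0 (loopBlock M p j k (j (k + 2)) (by omega)) := by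
  rw [← preBlock_submatrix M p j k hk]
  exact lastMinor_add_corner 0 _ _ _ (loopBlock_apply M p j (k + 1) e hk)

theorem lastMinor_one_loopBlock_succ (k e : ℕ) (hk : k + 1 + 2 ≤ n) :
    lastMinor 1 (loopBlock M p j (k + 1) e hk) = lastMinor 1 (preBlock M p j (k + 1) hk) +
      (p : ℤ[X]) ^ e * lastMinor 1 (loopBlock M p j k (j (k + 2)) (by omega)) := by
  rw [← preBlock_submatrix M p j k hk]
  exact lastMinor_add_corner 1 _ _ _ (loopBlock_apply M p j (k + 1) e hk)

theorem lastMinor_one_constMatrix_two : lastMinor 1 (constMatrix (0 + 2) p (0 + 1) 0 j) = p := by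
  simp [lastMinor, constMatrix]

theorem natDegree_lastMinor_loopBlock_le (k : ℕ) (hk : k + 2 ≤ n) (r : Fin (k + 2)) :
    (lastMinor r (loopBlock M p j k (j (k + 2)) hk)).natDegree ≤ k + 1 := by
  have : loopBlock M p j k (j (k + 2)) (by omega) =
      topLeft (loopMatrix M p j (k + 1)) (k + 2) (by omega) := rfl
  rw [this, loopMatrix_eq_pencil]
  exact natDegree_lastMinor_pencil_le r (topLeft M.adjugate (k + 2) hk)
    (topLeft (constMatrix n p (k + 1) (k + 1) j) (k + 2) hk)

variable {p}

theorem eval_zero_lastMinor_one_loopBlock (k e : ℕ) (hk : k + 2 ≤ n)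
    (h : ∀ k' (hk' : k = k' + 1), LoopInvariant M p j k' (j (k' + 2)) (by omega)) :
    ∃ N, (lastMinor 1 (loopBlock M p j k e hk)).eval 0 = (p : ℤ) ^ N := by
  cases k with
  | zero =>
    refine ⟨1, ?_⟩
    rw [lastMinor_one_loopBlock_zero, mul_zero, add_zero, eval_zero_lastMinor_preBlock,
      lastMinor_one_constMatrix_two, pow_one]
  | succ k =>
    obtain ⟨-, N, hN⟩ := h k rfl
    refine ⟨e + N, ?_⟩
    rw [lastMinor_one_loopBlock_succ, eval_add, eval_zero_lastMinor_preBlock,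
      lastMinor_one_constMatrix, eval_mul, hN]
    simp [pow_add]

/-- Every pass through the loop ends with a small exponent. -/
theorem exists_exponent_loop (hp : 2 ≤ p) (k : ℕ) (hk : k + 2 ≤ n)
    (h : ∀ k' (hk' : k = k' + 1), LoopInvariant M p j k' (j (k' + 2)) (by omega)) :
    ∃ e, 0 < e ∧ e ≤ 2 * k + 2 ∧
      RatCoprime (lastMinor 0 (loopBlock M p j k e hk)) (lastMinor 1 (loopBlock M p j k e hk)) := by
  have hp0 : p ≠ 0 := by omega
  have hdeg : ∀ r, (lastMinor r (preBlock M p j k hk)).natDegree ≤ k + 1 := fun r =>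
    natDegree_lastMinor_pencil_le r _ _
  cases k with
  | zero =>
    simp only [lastMinor_zero_loopBlock_zero, lastMinor_one_loopBlock_zero]
    obtain ⟨e, he, he', hc⟩ := exists_exponent (p := p) (δ := 1) hp
      (g₁ := lastMinor 0 (preBlock M p j 0 hk)) (g₂ := lastMinor 1 (preBlock M p j 0 hk))
      (h₁ := 1) (h₂ := 0) (by simp [RatCoprime, isCoprime_one_left])
      (by
        rw [zero_mul, one_mul, zero_sub, neg_ne_zero]
        intro h0
        have := eval_zero_lastMinor_preBlock M p j 0 hk 1
        rw [h0, lastMinor_one_constMatrix_two, eval_zero] at this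
        exact hp0 (by exact_mod_cast this.symm))
      (by
        rw [zero_mul, one_mul, zero_sub, natDegree_neg]
        exact hdeg 1)
    exact ⟨e, he, by omega, hc⟩
  | succ k =>
    obtain ⟨hcop, N, hN⟩ := h k rfl
    simp only [lastMinor_zero_loopBlock_succ, lastMinor_one_loopBlock_succ]
    have d := fun r => natDegree_lastMinor_loopBlock_le M p j k (by omega) r
    obtain ⟨e, he, he', hc⟩ := exists_exponent (p := p) (δ := 2 * k + 3) hp
      (g₁ := lastMinor 0 (preBlock M p j (k + 1) hk))
      (g₂ := lastMinor 1 (preBlock M p j (k + 1) hk)) hcop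
      (by
        intro h0
        have := congrArg (eval 0) h0
        rw [eval_sub, eval_mul, eval_mul, hN, eval_zero_lastMinor_preBlock,
          eval_zero_lastMinor_preBlock, lastMinor_one_constMatrix, mul_zero, sub_zero,
          eval_zero] at this
        exact mul_ne_zero (pow_ne_zero _ (by exact_mod_cast hp0))
          (lastMinor_zero_constMatrix hp0 k j) this)
      (by
        refine (natDegree_sub_le _ _).trans (max_le ?_ ?_)
        · exact natDegree_mul_le.trans (by linarith [d 1, hdeg 0])
        · exact natDegree_mul_le.trans (by linarith [d 0, hdeg 1]))
    exact ⟨e, he, by omega, hc⟩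

/-- The exponents among which the loop chooses the least. -/
def exponentSet (p : ℕ) (k : ℕ) (hk : k + 2 ≤ n) : Set ℕ :=
  {e : ℕ | 0 < e ∧
    detC (adjLast₁ (by omega) (topLeft (loopStep p (k + 2) e (loopMatrix M p j k)) (k + 2) hk))
      (adjLast₂ (by omega) (topLeft (loopStep p (k + 2) e (loopMatrix M p j k)) (k + 2) hk)) ≠ 0}

theorem ratCoprime_adjLast_iff {k : ℕ} (h : 2 ≤ k + 2)
    (V : Matrix (Fin (k + 2)) (Fin (k + 2)) ℤ[X]) :
    RatCoprime (adjLast₁ h V) (adjLast₂ h V) ↔ RatCoprime (lastMinor 0 V) (lastMinor 1 V) := by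
  simp only [ratCoprime_iff, adjLast₁_eq, adjLast₂_eq, map_mul, map_pow, map_neg, map_one, ne_eq,
    mul_eq_zero, pow_eq_zero_iff', neg_eq_zero, one_ne_zero, false_and, false_or]

theorem mem_exponentSet_iff (hp : 2 ≤ p) (k e : ℕ) (hk : k + 2 ≤ n)
    (h : ∀ k' (hk' : k = k' + 1), LoopInvariant M p j k' (j (k' + 2)) (by omega)) :
    e ∈ exponentSet M j p k hk ↔ 0 < e ∧ LoopInvariant M p j k e hk := by
  have hc := ratCoprime_adjLast_iff (by omega) (loopBlock M p j k e hk)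
  obtain ⟨N, hN⟩ := eval_zero_lastMinor_one_loopBlock M j k e hk h
  refine and_congr_right fun _ => ⟨fun hd => ⟨hc.mp ?_, N, hN⟩, fun hd => ?_⟩
  · refine ratCoprime_of_detC_ne_zero ?_ hd
    rw [adjLast₂_eq]
    refine mul_ne_zero (by simp) fun h0 => ?_
    rw [h0, eval_zero] at hN
    exact pow_ne_zero N (by exact_mod_cast (by omega : p ≠ 0)) hN.symm
  · exact detC_ne_zero (hc.mpr hd.1)

theorem loopInvariant_of_isLeast (hp : 2 ≤ p) (k : ℕ) (hk : k + 2 ≤ n)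
    (h : ∀ k' ≤ k, ∀ hk' : k' + 2 ≤ n, IsLeast (exponentSet M j p k' hk') (j (k' + 2))) :
    LoopInvariant M p j k (j (k + 2)) hk ∧ j (k + 2) ≤ 2 * k + 2 := by
  induction k with
  | zero =>
    have h0 : ∀ k' (hk' : 0 = k' + 1), LoopInvariant M p j k' (j (k' + 2)) (by omega) :=
      fun k' hk' => absurd hk' (by omega)
    have hl := h 0 le_rfl hk
    refine ⟨((mem_exponentSet_iff M j hp 0 _ hk h0).mp hl.1).2, ?_⟩
    obtain ⟨e, he, he', hc⟩ := exists_exponent_loop M j hp 0 hk h0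
    exact (hl.2 ((mem_exponentSet_iff M j hp 0 _ hk h0).mpr
      ⟨he, hc, eval_zero_lastMinor_one_loopBlock M j 0 e hk h0⟩)).trans he'
  | succ k ih =>
    have ih' := ih (by omega) (fun k' hk' => h k' (by omega))
    have h0 : ∀ k' (hk' : k + 1 = k' + 1), LoopInvariant M p j k' (j (k' + 2)) (by omega) := by
      intro k' hk'
      obtain rfl : k = k' := by omega
      exact ih'.1
    have hl := h (k + 1) le_rfl hk
    refine ⟨((mem_exponentSet_iff M j hp _ _ hk h0).mp hl.1).2, ?_⟩
    obtain ⟨e, he, he', hc⟩ := exists_exponent_loop M j hp _ hk h0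
    exact (hl.2 ((mem_exponentSet_iff M j hp _ _ hk h0).mpr
      ⟨he, hc, eval_zero_lastMinor_one_loopBlock M j _ e hk h0⟩)).trans he'

theorem loopMatrix_congr {j j' : ℕ → ℕ} (k : ℕ) (h : ∀ i ≤ k + 1, j i = j' i) :
    loopMatrix M p j k = loopMatrix M p j' k := by
  induction k with
  | zero => rfl
  | succ k ih => rw [loopMatrix, loopMatrix, ih (fun i hi => h i (by omega)), h (k + 2) le_rfl]

theorem exponentSet_congr {j j' : ℕ → ℕ} (k : ℕ) (hk : k + 2 ≤ n)
    (h : ∀ i ≤ k + 1, j i = j' i) : exponentSet M j p k hk = exponentSet M j' p k hk := by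
  simp only [exponentSet, loopMatrix_congr M k h]

/-- The loop can be carried out. -/
theorem exists_exponents (hp : 2 ≤ p) (K : ℕ) :
    ∃ j : ℕ → ℕ, ∀ k < K, ∀ hk : k + 2 ≤ n, IsLeast (exponentSet M j p k hk) (j (k + 2)) := by
  classical
  induction K with
  | zero => exact ⟨fun _ => 0, fun k hk => absurd hk (by omega)⟩
  | succ K ih =>
    obtain ⟨j, hj⟩ := ih
    by_cases hK : K + 2 ≤ n
    · have h0 : ∀ k' (hk' : K = k' + 1), LoopInvariant M p j k' (j (k' + 2)) (by omega) := by
        intro k' hk'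
        exact (loopInvariant_of_isLeast M j hp k' (by omega)
          (fun k'' h'' => hj k'' (by omega))).1
      have hne : (exponentSet M j p K hK).Nonempty := by
        obtain ⟨e, he, -, hc⟩ := exists_exponent_loop M j hp K hK h0
        exact ⟨e, (mem_exponentSet_iff M j hp K e hK h0).mpr
          ⟨he, hc, eval_zero_lastMinor_one_loopBlock M j K e hK h0⟩⟩
      have hcongr : ∀ k ≤ K, ∀ i ≤ k + 1,
          Function.update j (K + 2) (sInf (exponentSet M j p K hK)) i = j i := by
        intro k hk i hi
        rw [Function.update_of_ne (by omega)]
      refine ⟨Function.update j (K + 2) (sInf (exponentSet M j p K hK)), fun k hk hk' => ?_⟩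
      rw [exponentSet_congr M k hk' (hcongr k (by omega))]
      rcases Nat.lt_succ_iff_lt_or_eq.mp hk with hlt | rfl
      · rw [Function.update_of_ne (by omega)]
        exact hj k hlt hk'
      · rw [Function.update_self]
        exact ⟨Nat.sInf_mem hne, fun e he => Nat.sInf_le he⟩
    · refine ⟨j, fun k hk hk' => hj k ?_ hk'⟩
      have : k ≠ K := by rintro rfl; exact hK hk'
      omega

end Loop

/-! ### The substituted value and the new matrix -/

theorem coprimePart_spec {p : ℕ} (hp : p.Prime) {c : ℤ} (hc : c ≠ 0) :
    2 ≤ |coprimePart p c| ∧ ¬ (p : ℤ) ∣ coprimePart p c ∧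
      ∀ q : ℕ, q.Prime → q ≠ p → (q : ℤ) ∣ c → (q : ℤ) ∣ coprimePart p c := by
  have : Fact p.Prime := ⟨hp⟩
  have hp2 := hp.two_le
  have hcop : ∀ q : ℕ, q.Prime → q ≠ p → ∀ v : ℕ, IsCoprime (q : ℤ) ((p : ℤ) ^ v) := by
    intro q hq hqp v
    exact IsCoprime.pow_right (Nat.isCoprime_iff_coprime.mpr ((Nat.coprime_primes hq hp).mpr hqp))
  unfold coprimePart
  split_ifs with h
  · refine ⟨?_, ?_, fun q hq hqp hqc => ?_⟩
    · rw [abs_of_nonneg (by positivity)]; omega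
    · intro hd
      have h1 : (p : ℤ) ∣ 1 := (dvd_add_right (dvd_refl _)).mp hd
      have := Int.le_of_dvd one_pos h1
      omega
    · exfalso
      have h1 : (q : ℤ) ∣ (p : ℤ) ^ padicValInt p c := by rw [← h]; exact (dvd_abs _ _).mpr hqc
      have := (hcop q hq hqp (padicValInt p c)).isUnit_of_dvd' dvd_rfl h1
      exact (Nat.prime_iff_prime_int.mp hq).not_isUnit this
  · have hdvd : (p : ℤ) ^ padicValInt p c ∣ c := padicValInt_dvd c
    obtain ⟨d, hd⟩ := hdvd
    have hppos : (0 : ℤ) < (p : ℤ) ^ padicValInt p c := by positivity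
    have hquot : c / (p : ℤ) ^ padicValInt p c = d := by
      conv_lhs => lhs; rw [hd]
      exact Int.mul_ediv_cancel_left _ hppos.ne'
    rw [hquot]
    refine ⟨?_, ?_, fun q hq hqp hqc => ?_⟩
    · have hd0 : d ≠ 0 := by rintro rfl; exact hc (by rw [hd, mul_zero])
      have h1 : |d| ≠ 1 := by
        intro h1
        apply h
        conv_lhs => rw [hd]
        rw [abs_mul, h1, mul_one, abs_of_pos hppos]
      have := abs_pos.mpr hd0
      omega
    · rintro ⟨u, hu⟩
      have h1 : (p : ℤ) ^ (padicValInt p c + 1) ∣ c := ⟨u, by rw [pow_succ, mul_assoc, ← hu, ← hd]⟩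
      rcases (padicValInt_dvd_iff _ _).mp h1 with h2 | h2
      · exact hc h2
      · omega
    · rw [hd] at hqc
      exact (hcop q hq hqp _).dvd_of_dvd_mul_left hqc

section Final

variable {n : ℕ} (hn : 2 ≤ n) (M : Matrix (Fin n) (Fin n) ℤ) {p : ℕ} (j : ℕ → ℕ)

theorem finalMatrix_eq_pencil :
    finalMatrix M p j = pencil M.adjugate (constMatrix n p (n - 1) (n - 1) j) :=
  loopMatrix_eq_pencil M p j (n - 1)

theorem map_adjLast₁ {R S : Type} [CommRing R] [CommRing S] (φ : R →+* S)
    (V : Matrix (Fin n) (Fin n) R) : φ (adjLast₁ hn V) = adjLast₁ hn (V.map φ) :=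
  congrFun (congrFun (RingHom.map_adjugate φ V) _) _

theorem map_adjLast₂ {R S : Type} [CommRing R] [CommRing S] (φ : R →+* S)
    (V : Matrix (Fin n) (Fin n) R) : φ (adjLast₂ hn V) = adjLast₂ hn (V.map φ) :=
  congrFun (congrFun (RingHom.map_adjugate φ V) _) _

theorem finalMatrix_invariant (hp : 2 ≤ p)
    (h : ∀ k, ∀ hk : k + 2 ≤ n, IsLeast (exponentSet M j p k hk) (j (k + 2))) :
    RatCoprime (adjLast₁ hn (finalMatrix M p j)) (adjLast₂ hn (finalMatrix M p j)) ∧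
      ∃ N, |(adjLast₂ hn (finalMatrix M p j)).eval 0| = (p : ℤ) ^ N := by
  obtain ⟨k, rfl⟩ := Nat.exists_eq_add_of_le' hn
  obtain ⟨⟨h1, N, hN⟩, -⟩ := loopInvariant_of_isLeast M j hp k le_rfl (fun k' _ => h k')
  have e : loopBlock M p j k (j (k + 2)) le_rfl = finalMatrix M p j := rfl
  rw [e] at h1 hN
  refine ⟨(ratCoprime_adjLast_iff hn _).mpr h1, N, ?_⟩
  rw [adjLast₂_eq, eval_mul, hN, abs_mul]
  simp

/-- Modulo `p` only the multiple of `adj M` remains of `t adj M + A`. -/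
theorem not_dvd_adjLast₁ [Fact p.Prime] {t : ℤ} (ht : ¬ (p : ℤ) ∣ t)
    (hM : ¬ (p : ℤ) ∣ bottomLeft hn M * M.det) (hj : ∀ k, k + 2 ≤ n → 0 < j (k + 2)) :
    ¬ (p : ℤ) ∣ adjLast₁ hn (t • M.adjugate + constMatrix n p (n - 1) (n - 1) j) := by
  set φ := Int.castRingHom (ZMod p)
  have hφ : ∀ z : ℤ, φ z = 0 ↔ (p : ℤ) ∣ z := fun z => ZMod.intCast_zmod_eq_zero_iff_dvd z p
  have hmap : (t • M.adjugate + constMatrix n p (n - 1) (n - 1) j).map φ =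
      φ t • (M.map φ).adjugate := by
    have h1 : (M.map φ).adjugate = M.adjugate.map φ := (RingHom.map_adjugate φ M).symm
    rw [h1]
    ext r s
    have h2 : φ (constMatrix n p (n - 1) (n - 1) j r s) = 0 := by
      rw [hφ]
      simp only [constMatrix, Matrix.of_apply]
      refine dvd_add (dvd_add ?_ ?_) ?_
      · split_ifs <;> simp
      · split_ifs <;> simp
      · split_ifs with h
        · have := hj (r - 1) (by omega)
          rw [show (r : ℕ) - 1 + 2 = r + 1 by omega] at this
          exact dvd_pow_self _ this.ne'
        · simp
    simp only [Matrix.map_apply, Matrix.add_apply, Matrix.smul_apply, smul_eq_mul, map_add, h2,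
      add_zero, map_mul]
  rw [← hφ, map_adjLast₁, hmap, adjLast₁, Matrix.adjugate_smul, Matrix.adjugate_adjugate _
    (by rw [Fintype.card_fin]; omega)]
  have hdet : (M.map φ).det = φ M.det := (RingHom.map_det φ M).symm
  simp only [Matrix.smul_apply, smul_eq_mul, hdet]
  rw [← hφ, map_mul, mul_eq_zero, not_or] at hM
  rw [← hφ] at ht
  exact mul_ne_zero (pow_ne_zero _ ht) (mul_ne_zero (pow_ne_zero _ hM.2) hM.1)

theorem newMatrix_eq (a : ℕ) : newMatrix hn a M p j =
    substValue hn a M p j • M.adjugate + constMatrix n p (n - 1) (n - 1) j := by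
  have := map_eval_pencil M.adjugate (constMatrix n p (n - 1) (n - 1) j) (substValue hn a M p j)
  rw [← finalMatrix_eq_pencil] at this
  exact this

theorem bottomLeft_pos {M : Matrix (Fin n) (Fin n) ℤ} (hdet : M.det ≠ 0)
    (hmax : ∀ i k, |M i k| ≤ bottomLeft hn M) : 1 ≤ bottomLeft hn M := by
  by_contra hlt
  apply hdet
  have : M = 0 := by
    ext i k
    have := hmax i k
    exact abs_nonpos_iff.mp (by omega)
  rw [this]
  have : Nonempty (Fin n) := ⟨⟨0, by omega⟩⟩
  exact Matrix.det_zero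

theorem abs_substValue_ge {a : ℕ} (hb : 2 ≤ |base hn M p j|) :
    (a : ℝ) ^ 2 * (2 * (bottomLeft hn M : ℝ) * n) ^ (3 * n) ≤ |(substValue hn a M p j : ℝ)| := by
  set x := (a : ℝ) ^ 2 * (2 * (bottomLeft hn M : ℝ) * n) ^ (3 * n)
  have hb' : (1 : ℝ) < |(base hn M p j : ℝ)| := by
    have : (2 : ℝ) ≤ |(base hn M p j : ℝ)| := by exact_mod_cast hb
    linarith
  rw [substValue, Int.cast_pow, abs_pow]
  rcases le_or_gt x 0 with hx | hx
  · exact hx.trans (by positivity)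
  calc x = |(base hn M p j : ℝ)| ^ Real.logb |(base hn M p j : ℝ)| x :=
        (Real.rpow_logb (by linarith) hb'.ne' hx).symm
    _ ≤ |(base hn M p j : ℝ)| ^ ((⌈Real.logb |(base hn M p j : ℝ)| x⌉₊ : ℕ) : ℝ) :=
        Real.rpow_le_rpow_of_exponent_le hb'.le (Nat.le_ceil _)
    _ = _ := Real.rpow_natCast _ _

/-- A common prime factor of the two entries is not `p`, by reduction modulo `p`. Any other prime
factor divides the determinant of the coefficient matrix, hence the substituted value `t`, hence
the constant term of the second polynomial; but that is a power of `p` up to sign. -/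
theorem isCoprime_newMatrix (hp : p.Prime) {a : ℕ} (ha : 1 ≤ a) (hdet : M.det ≠ 0)
    (hmax : ∀ i k, |M i k| ≤ bottomLeft hn M) (hM : ¬ (p : ℤ) ∣ bottomLeft hn M * M.det)
    (h : ∀ k, ∀ hk : k + 2 ≤ n, IsLeast (exponentSet M j p k hk) (j (k + 2))) :
    IsCoprime (adjLast₁ hn (newMatrix hn a M p j)) (adjLast₂ hn (newMatrix hn a M p j)) := by
  have : Fact p.Prime := ⟨hp⟩
  obtain ⟨hcop, N, hN⟩ := finalMatrix_invariant hn M j hp.two_le h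
  obtain ⟨hb2, hbp, hbq⟩ := coprimePart_spec hp (detC_ne_zero hcop)
  set f := adjLast₁ hn (finalMatrix M p j) with hf
  set g := adjLast₂ hn (finalMatrix M p j) with hg
  set t := substValue hn a M p j with ht
  have hexp : ∃ e, e ≠ 0 ∧ t = base hn M p j ^ e := by
    refine ⟨_, ?_, rfl⟩
    have hm := bottomLeft_pos hn hdet hmax
    have hge := abs_substValue_ge hn M j (p := p) (a := a) hb2
    intro h0
    rw [substValue, h0, pow_zero, Int.cast_one, abs_one] at hge
    have h1 : (1 : ℝ) ≤ (a : ℝ) ^ 2 := one_le_pow₀ (by exact_mod_cast ha)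
    have hm' : (1 : ℝ) ≤ (bottomLeft hn M : ℝ) := by exact_mod_cast hm
    have hn' : (2 : ℝ) ≤ n := by exact_mod_cast hn
    have h2 : (1 : ℝ) < (2 * (bottomLeft hn M : ℝ) * n) ^ (3 * n) :=
      one_lt_pow₀ (by nlinarith) (by omega)
    nlinarith
  obtain ⟨e, he, hte⟩ := hexp
  have hpt : ¬ (p : ℤ) ∣ t := by
    rw [hte]
    exact fun hd => hbp ((Nat.prime_iff_prime_int.mp hp).dvd_of_dvd_pow hd)
  have hft : adjLast₁ hn (newMatrix hn a M p j) = f.eval t :=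
      (map_adjLast₁ hn (evalRingHom t) _).symm
  have hgt : adjLast₂ hn (newMatrix hn a M p j) = g.eval t :=
      (map_adjLast₂ hn (evalRingHom t) _).symm
  have hpf : ¬ (p : ℤ) ∣ f.eval t := by
    rw [← hft, newMatrix_eq]
    exact not_dvd_adjLast₁ hn M j hpt hM fun k hk => (h k hk).1.1
  rw [hft, hgt, Int.isCoprime_iff_gcd_eq_one, Int.gcd_eq_natAbs]
  refine Nat.coprime_of_dvd fun q hq hqf hqg => ?_
  rw [← Int.natCast_dvd] at hqf hqg
  have hqp : q ≠ p := by rintro rfl; exact hpf hqf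
  -- a prime other than `p` cannot divide the constant term of `g`
  have hqg0 : ¬ (q : ℤ) ∣ g.eval 0 := by
    intro hd
    rw [← dvd_abs, hN] at hd
    have := (Nat.prime_iff_prime_int.mp hq).dvd_of_dvd_pow hd
    exact hqp ((Nat.prime_dvd_prime_iff_eq hq hp).mp (by exact_mod_cast this))
  by_cases hd : f.natDegree ≠ 0 ∨ g.natDegree ≠ 0
  · obtain ⟨u, v, huv⟩ := exists_mul_add_mul_eq_C_detC f g hd
    have huv' := congrArg (eval t) huv
    rw [eval_add, eval_mul, eval_mul, eval_C] at huv'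
    have hqC : (q : ℤ) ∣ detC f g := by
      rw [← huv']
      exact dvd_add (hqf.mul_right _) (hqg.mul_right _)
    have hqt : (q : ℤ) ∣ t := by
      rw [hte]
      exact dvd_pow (hbq q hq hqp hqC) he
    have hsub : (q : ℤ) ∣ g.eval t - g.eval 0 :=
      hqt.trans (by simpa using sub_dvd_eval_sub t 0 g)
    exact hqg0 ((dvd_sub_right hqg).mp hsub)
  · have : g.natDegree = 0 := by omega
    obtain ⟨c, hc⟩ := natDegree_eq_zero.mp this
    rw [← hc, eval_C] at hqg hqg0
    exact hqg0 hqg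

/-- All steps of the algorithm can be carried out. -/
theorem nonempty_execution {a : ℕ} (ha : 1 ≤ a) (hdet : M.det ≠ 0)
    (hmax : ∀ i k, |M i k| ≤ bottomLeft hn M) : Nonempty (Execution hn a M) := by
  have hm := bottomLeft_pos hn hdet hmax
  have hprod : bottomLeft hn M * M.det ≠ 0 := mul_ne_zero (by omega) hdet
  have hne : {q : ℕ | q.Prime ∧ ¬ (q : ℤ) ∣ bottomLeft hn M * M.det}.Nonempty := by
    obtain ⟨q, hq, hqp⟩ := Nat.exists_infinite_primes ((bottomLeft hn M * M.det).natAbs + 1)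
    refine ⟨q, hqp, fun hd => ?_⟩
    have := Nat.le_of_dvd (Int.natAbs_pos.mpr hprod) (Int.natCast_dvd.mp hd)
    omega
  obtain ⟨p, hpl⟩ : ∃ p, IsLeast {q : ℕ | q.Prime ∧ ¬ (q : ℤ) ∣ bottomLeft hn M * M.det} p :=
    ⟨sInf _, Nat.sInf_mem hne, fun _ hq => Nat.sInf_le hq⟩
  obtain ⟨j, hj⟩ := exists_exponents M hpl.1.1.two_le n
  have hj' : ∀ k, ∀ hk : k + 2 ≤ n, IsLeast (exponentSet M j p k hk) (j (k + 2)) :=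
    fun k hk => hj k (by omega) hk
  obtain ⟨u, v, huv⟩ := isCoprime_newMatrix hn M j hpl.1.1 ha hdet hmax hpl.1.2 hj'
  let S : Set ℕ := {k | ∃ u v : ℤ, u * adjLast₁ hn (newMatrix hn a M p j) +
    v * adjLast₂ hn (newMatrix hn a M p j) = 1 ∧ u.natAbs = k}
  have hS : S.Nonempty := ⟨_, u, v, huv, rfl⟩
  obtain ⟨b₁, b₂, hb, hb'⟩ := Nat.sInf_mem hS
  refine ⟨⟨p, hpl, j, hj', b₁, b₂, hb, fun u v huv => ?_⟩⟩
  have h1 : sInf S ≤ u.natAbs := Nat.sInf_le ⟨u, v, huv, rfl⟩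
  rw [← hb'] at h1
  rw [Int.abs_eq_natAbs, Int.abs_eq_natAbs]
  exact_mod_cast h1

end Final

/-! ### The least prime not dividing a given number -/

theorem exists_prime_not_dvd_of_list {N B : ℕ} (hN : 0 < N) (hNB : N ≤ B) (l : List ℕ)
    (hl : l.Nodup) (hp : ∀ q ∈ l, q.Prime) (hB : B < l.prod) : ∃ q ∈ l, ¬ q ∣ N := by
  by_contra! h
  have h1 : ∏ q ∈ l.toFinset, q ∣ N :=
    Finset.prod_primes_dvd N (fun q hq => (hp q (List.mem_toFinset.mp hq)).prime)
      (fun q hq => h q (List.mem_toFinset.mp hq))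
  rw [List.prod_toFinset _ hl, List.map_id'] at h1
  have := Nat.le_of_dvd hN h1
  omega

theorem log_le_mul_self {y : ℝ} (hy : 0 < y) : Real.log y ≤ 0.37 * y := by
  have h1 := Real.log_le_sub_one_of_pos (x := y * Real.exp (-1)) (by positivity)
  rw [Real.log_mul hy.ne' (Real.exp_pos _).ne', Real.log_exp] at h1
  have h2 : Real.exp (-1) ≤ 0.37 := by
    have := Real.exp_one_gt_d9
    rw [Real.exp_neg, inv_le_comm₀ (Real.exp_pos _) (by norm_num)]
    norm_num
    linarith
  nlinarith

/-- Chebyshev's lower bound for the primorial of `r³`, against `L ^ (L + 1)` with `2 L < (r + 1)²`.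
-/
theorem pow_lt_primorial {r L : ℕ} (hr : 12 ≤ r) (hL0 : 0 < L) (hL : 2 * L ≤ r ^ 2 + 2 * r) :
    L ^ (L + 1) < primorial (r ^ 3) := by
  have hcheb := Chebyshev.theta_ge (r ^ 3)
  rw [Chebyshev.theta_eq_log_primorial, Nat.floor_natCast] at hcheb
  obtain ⟨y, hy0, hyr⟩ : ∃ y : ℝ, 0 < y ∧ y ^ 2 = r :=
    ⟨√r, Real.sqrt_pos.mpr (by exact_mod_cast (by omega : 0 < r)), Real.sq_sqrt (by positivity)⟩
  have hr' : (12 : ℝ) ≤ y ^ 2 := by rw [hyr]; exact_mod_cast hr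
  have hy : (3.46 : ℝ) ≤ y := by nlinarith
  have hcast : ((r ^ 3 : ℕ) : ℝ) = y ^ 6 := by push_cast; rw [← hyr]; ring
  have hsqrt : √((r ^ 3 : ℕ) : ℝ) = y ^ 3 := by
    rw [hcast, show y ^ 6 = (y ^ 3) ^ 2 by ring, Real.sqrt_sq (by positivity)]
  rw [hsqrt, hcast] at hcheb
  have hlogy := log_le_mul_self hy0
  have hlog2 := Real.log_two_gt_d9
  have hlog2' := Real.log_two_lt_d9
  have h1 : Real.log (y ^ 6) ≤ 2.22 * y := by
    rw [Real.log_pow]; push_cast; linarith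
  have h2 : Real.log (y ^ 6 + 1) ≤ 0.7 + 2.22 * y := by
    have : Real.log (y ^ 6 + 1) ≤ Real.log (2 * y ^ 6) := by
      apply Real.log_le_log (by positivity)
      have : 1 ≤ y ^ 6 := one_le_pow₀ (by linarith)
      linarith
    rw [Real.log_mul (by norm_num) (by positivity)] at this
    linarith
  have hLr : (L : ℝ) ≤ (y ^ 4 + 2 * y ^ 2) / 2 := by
    have : (2 * L : ℝ) ≤ r ^ 2 + 2 * r := by exact_mod_cast hL
    rw [← hyr] at this; linarith
  have hL0' : (0 : ℝ) < L := by exact_mod_cast hL0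
  have h3 : Real.log L ≤ 1.48 * y - 0.526 := by
    have e1 : (L : ℝ) ≤ y ^ 4 * (7 / 12) := by nlinarith
    have e2 := Real.log_le_log hL0' e1
    rw [Real.log_mul (by positivity) (by norm_num), Real.log_pow] at e2
    have e3 : Real.log (7 / 12) ≤ -0.526 := by
      have : (7 / 12 : ℝ) = 2⁻¹ * (7 / 6) := by norm_num
      rw [this, Real.log_mul (by norm_num) (by norm_num), Real.log_inv]
      have := Real.log_le_sub_one_of_pos (x := (7 / 6 : ℝ)) (by norm_num)
      linarith
    push_cast at e2
    linarith
  have h4 : ((L : ℝ) + 1) * Real.log L ≤ (y ^ 4 / 2 + y ^ 2 + 1) * (1.48 * y - 0.526) := by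
    apply mul_le_mul (by linarith) h3 (Real.log_natCast_nonneg L) (by positivity)
  have h5 : 2 * y ^ 3 * Real.log (y ^ 6) ≤ 2 * y ^ 3 * (2.22 * y) := by gcongr
  have h6 : y ^ 6 * 0.693 ≤ y ^ 6 * Real.log 2 := by
    gcongr; linarith
  have h7 : (1.5 : ℝ) ≤ 0.693 * y ^ 2 - 0.74 * y - 4.18 := by nlinarith
  have h8 : y ^ 4 * 1.5 ≤ y ^ 4 * (0.693 * y ^ 2 - 0.74 * y - 4.18) := by gcongr
  have h9 : 5.1 * y ^ 3 ≤ 1.5 * y ^ 4 := by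
    have : 0 ≤ y ^ 3 * (1.5 * y - 5.1) := mul_nonneg (by positivity) (by linarith)
    linarith
  have h10 : 12 * y ≤ y ^ 3 := by
    have : 0 ≤ y * (y ^ 2 - 12) := mul_nonneg hy0.le (by linarith)
    linarith
  have hlt : Real.log ((L ^ (L + 1) : ℕ) : ℝ) < Real.log (primorial (r ^ 3)) := by
    push_cast
    rw [Real.log_pow]
    push_cast
    nlinarith
  have := (Real.log_lt_log_iff (by exact_mod_cast pow_pos hL0 _)
    (by exact_mod_cast primorial_pos _)).mp hlt
  exact_mod_cast this

/-- The first prime that does not divide a number `N ≤ L ^ (L + 1)` is at most `(2 L) ^ (3 / 2)`. -/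
theorem exists_prime_not_dvd {N L : ℕ} (hL : 2 ≤ L) (hN : 0 < N) (hNL : N ≤ L ^ (L + 1)) :
    ∃ q, q.Prime ∧ ¬ q ∣ N ∧ q ^ 2 ≤ (2 * L) ^ 3 := by
  -- below `72` explicit lists of primes do what Chebyshev's bound does beyond
  have key : ∀ (l : List ℕ) (L₀ L₁ : ℕ), L₀ ≤ L → L ≤ L₁ → l.Nodup → (∀ q ∈ l, q.Prime) →
      (∀ q ∈ l, q ^ 2 ≤ (2 * L₀) ^ 3) → L₁ ^ (L₁ + 1) < l.prod →
      ∃ q, q.Prime ∧ ¬ q ∣ N ∧ q ^ 2 ≤ (2 * L) ^ 3 := by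
    intro l L₀ L₁ h0 h1 hl hp hq hprod
    have hB : N ≤ L₁ ^ (L₁ + 1) := hNL.trans
      ((Nat.pow_le_pow_left h1 _).trans (Nat.pow_le_pow_right (by omega) (by omega)))
    obtain ⟨q, hql, hqN⟩ := exists_prime_not_dvd_of_list hN hB l hl hp hprod
    exact ⟨q, hp q hql, hqN, (hq q hql).trans (by gcongr)⟩
  by_cases h3 : L ≤ 3
  · exact key [7, 5, 3] 2 3 hL h3 (by decide) (by norm_num) (by decide) (by norm_num)
  by_cases h7 : L ≤ 7
  · exact key [19, 17, 13, 11, 7, 5, 3, 2] 4 7 (by omega) h7 (by decide) (by norm_num) (by decide)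
      (by norm_num)
  by_cases h17 : L ≤ 17
  · exact key [61, 59, 53, 47, 43, 41, 37, 31, 29, 23, 19, 17, 13, 11, 7, 5] 8 17 (by omega) h17
      (by decide) (by norm_num) (by decide) (by norm_num)
  by_cases h48 : L ≤ 48
  · exact key [211, 199, 197, 193, 191, 181, 179, 173, 167, 163, 157, 151, 149, 139, 137, 131, 127,
      113, 109, 107, 103, 101, 97, 89, 83, 79, 73, 71, 67, 61, 59, 53, 47, 43, 41, 37, 31, 29, 23,
      19, 17, 13, 11, 7] 18 48 (by omega) h48 (by decide) (by norm_num) (by decide) (by norm_num)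
  by_cases h71 : L ≤ 71
  · exact key [967, 953, 947, 941, 937, 929, 919, 911, 907, 887, 883, 881, 877, 863, 859, 857, 853,
      839, 829, 827, 823, 821, 811, 809, 797, 787, 773, 769, 761, 757, 751, 743, 739, 733, 727, 719,
      709, 701, 691, 683, 677, 673, 661, 659, 653, 647] 49 71 (by omega) h71 (by decide)
      (by norm_num) (by decide) (by norm_num)
  set r := Nat.sqrt (2 * L)
  have hr1 : r ^ 2 ≤ 2 * L := Nat.sqrt_le' _
  have hr2 : 2 * L < (r + 1) ^ 2 := Nat.lt_succ_sqrt' _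
  have hr : 12 ≤ r := Nat.le_sqrt.mpr (by omega)
  have hprim := pow_lt_primorial hr (by omega) (by nlinarith : 2 * L ≤ r ^ 2 + 2 * r)
  by_contra! hcon
  have hdvd : primorial (r ^ 3) ∣ N := by
    refine Finset.prod_primes_dvd N (fun q hq => ?_) (fun q hq => ?_)
    · exact (Finset.mem_filter.mp hq).2.prime
    · obtain ⟨hq1, hq2⟩ := Finset.mem_filter.mp hq
      by_contra hqN
      have h1 := hcon q hq2 hqN
      have h2 : q ≤ r ^ 3 := by
        have := Finset.mem_range.mp hq1
        omega
      have h3 : q ^ 2 ≤ (r ^ 2) ^ 3 := by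
        calc q ^ 2 ≤ (r ^ 3) ^ 2 := by gcongr
          _ = (r ^ 2) ^ 3 := by ring
      have h4 : (r ^ 2) ^ 3 ≤ (2 * L) ^ 3 := by gcongr
      omega
  have := Nat.le_of_dvd hN hdvd
  omega

theorem natAbs_det_le {n : ℕ} (M : Matrix (Fin n) (Fin n) ℤ) {m : ℕ}
    (h : ∀ i k, |M i k| ≤ m) : M.det.natAbs ≤ (m * n) ^ n := by
  have h1 : |M.det| ≤ (Fintype.card (Fin n)).factorial • (m : ℤ) ^ Fintype.card (Fin n) :=
    Matrix.det_le (abv := AbsoluteValue.abs) h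
  rw [Fintype.card_fin, nsmul_eq_mul, Int.abs_eq_natAbs] at h1
  have h2 : M.det.natAbs ≤ n.factorial * m ^ n := by exact_mod_cast h1
  calc M.det.natAbs ≤ n.factorial * m ^ n := h2
    _ ≤ n ^ n * m ^ n := by gcongr; exact Nat.factorial_le_pow n
    _ = (m * n) ^ n := by rw [mul_pow, mul_comm]

/-- With `m` the largest entry of `M`, the number `m |det M|` is at most `(m n) ^ (m n + 1)`, so the
prime that the algorithm uses is at most `(2 m n) ^ (3 / 2)`. -/
theorem sq_least_prime_le {n : ℕ} (hn : 2 ≤ n) {M : Matrix (Fin n) (Fin n) ℤ} (hdet : M.det ≠ 0)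
    (hmax : ∀ i k, |M i k| ≤ bottomLeft hn M) {p : ℕ}
    (hp : IsLeast {q : ℕ | q.Prime ∧ ¬ (q : ℤ) ∣ bottomLeft hn M * M.det} p) :
    (p : ℤ) ^ 2 ≤ (2 * bottomLeft hn M * n) ^ 3 := by
  have hm := bottomLeft_pos hn hdet hmax
  obtain ⟨m, hm'⟩ := Int.eq_ofNat_of_zero_le (by omega : 0 ≤ bottomLeft hn M)
  rw [hm'] at hp hmax hm ⊢
  have hm1 : 1 ≤ m := by exact_mod_cast hm
  have hdle := natAbs_det_le M hmax
  have hL : n ≤ m * n := Nat.le_mul_of_pos_left n hm1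
  have hN : 0 < m * M.det.natAbs := Nat.mul_pos hm1 (Int.natAbs_pos.mpr hdet)
  obtain ⟨q, hq, hqN, hqL⟩ := exists_prime_not_dvd (L := m * n) (by omega) hN (by
    calc m * M.det.natAbs ≤ (m * n) * (m * n) ^ n := by
          gcongr; exact Nat.le_mul_of_pos_right m (by omega)
      _ = (m * n) ^ (n + 1) := by ring
      _ ≤ (m * n) ^ (m * n + 1) := by
          apply Nat.pow_le_pow_right <;> omega)
  have hpq : p ≤ q := hp.2 ⟨hq, fun hd => hqN (by
    rw [Int.natCast_dvd, Int.natAbs_mul] at hd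
    simpa using hd)⟩
  have : p ^ 2 ≤ (2 * (m * n)) ^ 3 := (Nat.pow_le_pow_left hpq 2).trans hqL
  rw [← mul_assoc] at this
  exact_mod_cast this

/-! ### The three norms -/

section Norm

variable {s : ℝ≥0∞} {n : ℕ}

theorem one_le_of_mem (hs : s = 1 ∨ s = 2 ∨ s = ∞) : 1 ≤ s := by
  rcases hs with rfl | rfl | rfl <;> norm_num

theorem lpNorm_one (v : Fin n → ℝ) : lpNorm 1 v = ∑ i, |v i| :=
  PiLp.norm_eq_of_L1 _

theorem lpNorm_two (v : Fin n → ℝ) : lpNorm 2 v = √(∑ i, v i ^ 2) := by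
  rw [lpNorm, PiLp.norm_eq_of_L2]
  simp only [Real.norm_eq_abs, sq_abs]

theorem lpNorm_top (v : Fin n → ℝ) : lpNorm ∞ v = ‖v‖ := PiLp.norm_toLp v

theorem lpNorm_nonneg (hs : 1 ≤ s) (v : Fin n → ℝ) : 0 ≤ lpNorm s v :=
  have : Fact (1 ≤ s) := ⟨hs⟩
  norm_nonneg _

theorem lpNorm_eq_zero (hs : 1 ≤ s) {v : Fin n → ℝ} : lpNorm s v = 0 ↔ v = 0 := by
  have : Fact (1 ≤ s) := ⟨hs⟩
  rw [lpNorm, norm_eq_zero, WithLp.toLp_eq_zero]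

theorem lpNorm_pos (hs : 1 ≤ s) {v : Fin n → ℝ} : 0 < lpNorm s v ↔ v ≠ 0 := by
  rw [(lpNorm_nonneg hs v).lt_iff_ne', Ne, lpNorm_eq_zero hs]

theorem lpNorm_smul (hs : 1 ≤ s) (c : ℝ) (v : Fin n → ℝ) :
    lpNorm s (c • v) = |c| * lpNorm s v := by
  have : Fact (1 ≤ s) := ⟨hs⟩
  rw [lpNorm, WithLp.toLp_smul, norm_smul, Real.norm_eq_abs, lpNorm]

theorem lpNorm_neg (hs : 1 ≤ s) (v : Fin n → ℝ) : lpNorm s (-v) = lpNorm s v := by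
  rw [← neg_one_smul ℝ, lpNorm_smul hs, abs_neg, abs_one, one_mul]

theorem lpNorm_add_le (hs : 1 ≤ s) (v w : Fin n → ℝ) :
    lpNorm s (v + w) ≤ lpNorm s v + lpNorm s w := by
  have : Fact (1 ≤ s) := ⟨hs⟩
  rw [lpNorm, WithLp.toLp_add]
  exact norm_add_le _ _

theorem lpNorm_sub_le (hs : 1 ≤ s) (v w : Fin n → ℝ) :
    lpNorm s v - lpNorm s w ≤ lpNorm s (v + w) := by
  have := lpNorm_add_le hs (v + w) (-w)
  rw [add_neg_cancel_right, lpNorm_neg hs] at this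
  linarith

theorem abs_le_lpNorm (hs : 1 ≤ s) (v : Fin n → ℝ) (i : Fin n) : |v i| ≤ lpNorm s v := by
  have : Fact (1 ≤ s) := ⟨hs⟩
  exact PiLp.norm_apply_le (WithLp.toLp s v) i

theorem lpNorm_le_of_forall (hs : s = 1 ∨ s = 2 ∨ s = ∞) {v : Fin n → ℝ} {r : ℝ} (hr : 0 ≤ r)
    (h : ∀ i, |v i| ≤ r) : lpNorm s v ≤ (n : ℝ) ^ (s⁻¹).toReal * r := by
  rcases hs with rfl | rfl | rfl
  · rw [lpNorm_one, inv_one, ENNReal.toReal_one, Real.rpow_one]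
    calc ∑ i, |v i| ≤ ∑ _i : Fin n, r := Finset.sum_le_sum fun i _ => h i
      _ = n * r := by simp
  · rw [lpNorm_two, ENNReal.toReal_inv, ENNReal.toReal_ofNat, ← one_div, ← Real.sqrt_eq_rpow]
    calc √(∑ i, v i ^ 2) ≤ √(∑ _i : Fin n, r ^ 2) := by
          refine Real.sqrt_le_sqrt (Finset.sum_le_sum fun i _ => ?_)
          rw [← sq_abs]
          exact pow_le_pow_left₀ (abs_nonneg _) (h i) 2
      _ = √n * r := by
          rw [Finset.sum_const, Finset.card_univ, Fintype.card_fin, nsmul_eq_mul,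
            Real.sqrt_mul (by positivity), Real.sqrt_sq hr]
  · rw [lpNorm_top, ENNReal.inv_top, ENNReal.toReal_zero, Real.rpow_zero, one_mul]
    exact (pi_norm_le_iff_of_nonneg hr).mpr h

theorem lpNorm_mulVec_le (hs : s = 1 ∨ s = 2 ∨ s = ∞) {B : Matrix (Fin n) (Fin n) ℝ} {β : ℝ}
    (hβ : 0 ≤ β) (h : ∀ i k, |B i k| ≤ β) (u : Fin n → ℝ) :
    lpNorm s (B.mulVec u) ≤ n * β * lpNorm s u := by
  have hrow : ∀ i, |B.mulVec u i| ≤ β * ∑ k, |u k| := by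
    intro i
    rw [Matrix.mulVec, dotProduct, Finset.mul_sum]
    refine (Finset.abs_sum_le_sum_abs _ _).trans (Finset.sum_le_sum fun k _ => ?_)
    rw [abs_mul]
    exact mul_le_mul_of_nonneg_right (h i k) (abs_nonneg _)
  rcases hs with rfl | rfl | rfl
  · rw [lpNorm_one, lpNorm_one]
    calc ∑ i, |B.mulVec u i| ≤ ∑ _i : Fin n, β * ∑ k, |u k| := Finset.sum_le_sum fun i _ => hrow i
      _ = n * β * ∑ k, |u k| := by simp [mul_assoc]
  · rw [lpNorm_two, lpNorm_two]
    apply Real.sqrt_le_iff.mpr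
    refine ⟨by positivity, ?_⟩
    have hcs : (∑ k, |u k|) ^ 2 ≤ n * ∑ k, u k ^ 2 := by
      have := sq_sum_le_card_mul_sum_sq (s := Finset.univ) (f := fun k => |u k|)
      simpa only [sq_abs, Finset.card_univ, Fintype.card_fin] using this
    have hS : 0 ≤ ∑ k, |u k| := Finset.sum_nonneg fun k _ => abs_nonneg _
    calc ∑ i, B.mulVec u i ^ 2 ≤ ∑ _i : Fin n, (β * ∑ k, |u k|) ^ 2 := by
          refine Finset.sum_le_sum fun i _ => ?_
          rw [← sq_abs]
          exact pow_le_pow_left₀ (abs_nonneg _) (hrow i) 2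
      _ = n * β ^ 2 * (∑ k, |u k|) ^ 2 := by simp; ring
      _ ≤ n * β ^ 2 * (n * ∑ k, u k ^ 2) := by gcongr
      _ = (n * β * √(∑ k, u k ^ 2)) ^ 2 := by
          rw [mul_pow _ (√_), Real.sq_sqrt (Finset.sum_nonneg fun k _ => sq_nonneg _)]; ring
  · rw [lpNorm_top, lpNorm_top, pi_norm_le_iff_of_nonneg (by positivity)]
    intro i
    refine (hrow i).trans ?_
    calc β * ∑ k, |u k| ≤ β * ∑ _k : Fin n, ‖u‖ := by
          gcongr with k
          exact norm_le_pi_norm u k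
      _ = n * β * ‖u‖ := by simp; ring

theorem exists_int_lpNorm (hs : s = 1 ∨ s = ∞) (v : Fin n → ℤ) :
    ∃ k : ℤ, lpNorm s (fun i => (v i : ℝ)) = k := by
  rcases hs with rfl | rfl
  · exact ⟨∑ i, |v i|, by rw [lpNorm_one]; push_cast; rfl⟩
  · rw [lpNorm_top]
    rcases isEmpty_or_nonempty (Fin n) with he | hne
    · refine ⟨0, ?_⟩
      rw [Int.cast_zero, norm_eq_zero]
      exact Subsingleton.elim _ _
    · obtain ⟨i, hi⟩ := Finite.exists_max fun i => |v i|
      refine ⟨|v i|, le_antisymm ?_ ?_⟩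
      · refine (pi_norm_le_iff_of_nonneg (by positivity)).mpr fun k => ?_
        rw [Real.norm_eq_abs]
        exact_mod_cast hi k
      · have := norm_le_pi_norm (fun i => (v i : ℝ)) i
        rw [Real.norm_eq_abs] at this
        exact_mod_cast this

theorem exists_int_sq_lpNorm (hs : s = 1 ∨ s = 2 ∨ s = ∞) (v : Fin n → ℤ) :
    ∃ k : ℤ, lpNorm s (fun i => (v i : ℝ)) ^ 2 = k := by
  have key : s = 1 ∨ s = ∞ → ∃ k : ℤ, lpNorm s (fun i => (v i : ℝ)) ^ 2 = k := by
    intro h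
    obtain ⟨k, hk⟩ := exists_int_lpNorm h v
    exact ⟨k ^ 2, by rw [hk]; push_cast; rfl⟩
  rcases hs with rfl | rfl | rfl
  · exact key (Or.inl rfl)
  · refine ⟨∑ i, v i ^ 2, ?_⟩
    rw [lpNorm_two, Real.sq_sqrt (Finset.sum_nonneg fun k _ => sq_nonneg _)]
    push_cast
    rfl
  · exact key (Or.inr rfl)

theorem one_le_rpow_inv (hn : 1 ≤ n) : 1 ≤ (n : ℝ) ^ (s⁻¹).toReal :=
  Real.one_le_rpow (by exact_mod_cast hn) ENNReal.toReal_nonneg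

theorem rpow_inv_le (hs : s = 1 ∨ s = 2 ∨ s = ∞) (hn : 1 ≤ n) :
    (n : ℝ) ^ (s⁻¹).toReal ≤ n := by
  have hn' : (1 : ℝ) ≤ n := by exact_mod_cast hn
  have : (s⁻¹).toReal ≤ 1 := by
    rcases hs with rfl | rfl | rfl
    · simp
    · rw [ENNReal.toReal_inv, ENNReal.toReal_ofNat]; norm_num
    · simp
  calc (n : ℝ) ^ (s⁻¹).toReal ≤ (n : ℝ) ^ (1 : ℝ) := Real.rpow_le_rpow_of_exponent_le hn' this
    _ = n := Real.rpow_one _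

/-- Norms of integer vectors take discrete values: an approximation of the bound `b μ ≤ a λ` that
is good enough implies the bound itself. For the Euclidean norm the values that are compared are
the squares, for the other norms the norms themselves. -/
theorem mul_lpNorm_le_of_sq_lt (hs : s = 1 ∨ s = 2 ∨ s = ∞) (hn : 1 ≤ n) {a b : ℕ} (ha : 1 ≤ a)
    (v w : Fin n → ℤ) {ρ : ℝ} (hρ : 1 ≤ ρ)
    (hw : lpNorm s (fun i => (w i : ℝ)) ≤ (n : ℝ) ^ (s⁻¹).toReal * ρ)
    (h : (b * lpNorm s (fun i => (v i : ℝ))) ^ 2 <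
      (a * lpNorm s (fun i => (w i : ℝ))) ^ 2 + lpNorm s (fun i => (w i : ℝ)) ^ 2 / (n * ρ ^ 2)) :
    b * lpNorm s (fun i => (v i : ℝ)) ≤ a * lpNorm s (fun i => (w i : ℝ)) := by
  have hv0 := lpNorm_nonneg (one_le_of_mem hs) fun i => (v i : ℝ)
  have hw0 := lpNorm_nonneg (one_le_of_mem hs) fun i => (w i : ℝ)
  have hn' : (1 : ℝ) ≤ n := by exact_mod_cast hn
  have ha' : (1 : ℝ) ≤ a := by exact_mod_cast ha
  have hnρ : 0 < n * ρ ^ 2 := by positivity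
  by_cases h1 : s = 1
  · subst h1
    rw [inv_one, ENNReal.toReal_one, Real.rpow_one] at hw
    obtain ⟨k, hk⟩ := exists_int_lpNorm (Or.inl rfl) v
    obtain ⟨l, hl⟩ := exists_int_lpNorm (Or.inl rfl) w
    rw [hk] at h hv0 ⊢
    rw [hl] at h hw hw0 ⊢
    by_contra! hcon
    have h2 : (a * l : ℤ) + 1 ≤ b * k := by
      have : (a * l : ℤ) < b * k := by exact_mod_cast hcon
      omega
    have h3 : (a : ℝ) * l + 1 ≤ b * k := by exact_mod_cast h2
    have h4 : ((a : ℝ) * l + 1) ^ 2 ≤ (b * k) ^ 2 := pow_le_pow_left₀ (by positivity) h3 2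
    have h5 : (l : ℝ) ^ 2 / (n * ρ ^ 2) ≤ l := by
      rw [div_le_iff₀ hnρ]
      calc (l : ℝ) ^ 2 = l * l := sq _
        _ ≤ l * (n * ρ) := by gcongr
        _ ≤ l * (n * ρ ^ 2) := by
            gcongr
            nlinarith
    nlinarith
  · have hs' : s = 2 ∨ s = ∞ := hs.resolve_left h1
    obtain ⟨k, hk⟩ := exists_int_sq_lpNorm hs v
    obtain ⟨l, hl⟩ := exists_int_sq_lpNorm hs w
    have hw2 : lpNorm s (fun i => (w i : ℝ)) ^ 2 ≤ n * ρ ^ 2 := by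
      have h2 : ((n : ℝ) ^ (s⁻¹).toReal) ^ 2 ≤ n := by
        rcases hs' with rfl | rfl
        · rw [ENNReal.toReal_inv, ENNReal.toReal_ofNat, ← one_div, ← Real.sqrt_eq_rpow,
            Real.sq_sqrt (by positivity)]
        · simpa using hn'
      calc lpNorm s (fun i => (w i : ℝ)) ^ 2 ≤ ((n : ℝ) ^ (s⁻¹).toReal * ρ) ^ 2 :=
            pow_le_pow_left₀ hw0 hw 2
        _ = ((n : ℝ) ^ (s⁻¹).toReal) ^ 2 * ρ ^ 2 := mul_pow _ _ _
        _ ≤ n * ρ ^ 2 := by gcongr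
    have h3 := (div_le_one hnρ).mpr hw2
    rw [mul_pow, mul_pow, hk, hl] at h
    rw [hl] at h3
    have h4 : (b : ℝ) ^ 2 * k < a ^ 2 * l + 1 := by linarith
    have h5 : (b : ℤ) ^ 2 * k ≤ a ^ 2 * l := Int.lt_add_one_iff.mp (by exact_mod_cast h4)
    have h6 : (b : ℝ) ^ 2 * k ≤ a ^ 2 * l := by exact_mod_cast h5
    rw [← hk, ← hl, ← mul_pow, ← mul_pow] at h6
    exact (sq_le_sq₀ (by positivity) (by positivity)).mp h6

end Norm

/-! ### Two facts on lattices -/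

/-- Minkowski's theorem for the cube. -/
theorem exists_mulVec_le {n : ℕ} (hn : 1 ≤ n) (M : Matrix (Fin n) (Fin n) ℤ) (hdet : M.det ≠ 0) :
    ∃ v : Fin n → ℤ, v ≠ 0 ∧ ∀ i, |((M.mulVec v i : ℤ) : ℝ)| ≤ |(M.det : ℝ)| ^ (1 / (n : ℝ)) := by
  set R : Matrix (Fin n) (Fin n) ℝ := M.map (Int.cast : ℤ → ℝ) with hR
  have hRdet : R.det = M.det := (RingHom.map_det (Int.castRingHom ℝ) M).symm
  have hRdet0 : R.det ≠ 0 := by rw [hRdet]; exact_mod_cast hdet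
  have : Nonempty (Fin n) := ⟨⟨0, by omega⟩⟩
  have hli : LinearIndependent ℝ R.col :=
    Matrix.linearIndependent_cols_of_det_ne_zero hRdet0
  classical
  obtain ⟨B, hB⟩ : ∃ B : Module.Basis (Fin n) ℝ (Fin n → ℝ), ⇑B = R.col :=
    ⟨basisOfPiSpaceOfLinearIndependent hli, coe_basisOfPiSpaceOfLinearIndependent hli⟩
  set ρ : ℝ := |(M.det : ℝ)| ^ (1 / (n : ℝ)) with hρ
  have hρ0 : 0 ≤ ρ := by positivity
  have hρn : ρ ^ n = |(M.det : ℝ)| := by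
    rw [hρ, ← Real.rpow_natCast, ← Real.rpow_mul (abs_nonneg _),
      one_div_mul_cancel (by positivity), Real.rpow_one]
  have hvol : MeasureTheory.volume (ZSpan.fundamentalDomain B) * 2 ^ Module.finrank ℝ (Fin n → ℝ) ≤
      MeasureTheory.volume (Metric.closedBall (0 : Fin n → ℝ) ρ) := by
    rw [ZSpan.volume_fundamentalDomain, Real.volume_pi_closedBall _ hρ0, hB,
      Module.finrank_fintype_fun_eq_card, Fintype.card_fin, mul_pow, hρn]
    have : (Matrix.of R.col).det = M.det := by rw [← hRdet, ← Matrix.det_transpose]; rfl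
    rw [this, mul_comm, ENNReal.ofReal_mul (by positivity), ENNReal.ofReal_pow (by norm_num)]
    simp
  have hcount : Countable (Submodule.span ℤ (Set.range B)).toAddSubgroup :=
    inferInstanceAs (Countable (Submodule.span ℤ (Set.range B)))
  obtain ⟨x, hx0, hx⟩ :=
    MeasureTheory.exists_ne_zero_mem_lattice_of_measure_mul_two_pow_le_measure
      (ZSpan.isAddFundamentalDomain' B MeasureTheory.volume) (by simp)
      (convex_closedBall (0 : Fin n → ℝ) ρ) (isCompact_closedBall 0 ρ) hvol
  obtain ⟨c, hc⟩ := (Submodule.mem_span_range_iff_exists_fun ℤ).mp x.2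
  have hxc : (x : Fin n → ℝ) = fun i => ((M.mulVec c i : ℤ) : ℝ) := by
    rw [← hc, hB]
    ext i
    simp [Matrix.mulVec, dotProduct, hR, mul_comm]
  refine ⟨c, ?_, fun i => ?_⟩
  · rintro rfl
    apply hx0
    ext1
    rw [hxc]
    ext i
    simp
  · rw [mem_closedBall_zero_iff] at hx
    have := (norm_le_pi_norm (x : Fin n → ℝ) i).trans hx
    rw [hxc] at this
    exact this

/-- If `adj T b` has a coordinate `1`, then `b` and the columns of `T` generate `ℤⁿ`: the order of
`b` in the quotient by the columns is a multiple of `det T`, which is the order of the quotient. -/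
theorem exists_eq_smul_add_mulVec {n : ℕ} {T : Matrix (Fin n) (Fin n) ℤ} (hdet : T.det ≠ 0)
    {b : Fin n → ℤ} {i₀ : Fin n} (hb : T.adjugate.mulVec b i₀ = 1) (v : Fin n → ℤ) :
    ∃ (q : ℤ) (k : Fin n → ℤ), v = q • b + T.mulVec k := by
  let f := Matrix.toLin' T
  have hinj : Function.Injective f := by
    intro x y hxy
    exact Matrix.mulVec_injective_of_det_ne_zero hdet hxy
  let N := LinearMap.range f
  let e : (Fin n → ℤ) ≃ₗ[ℤ] N := LinearEquiv.ofInjective f hinj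
  have hcard : T.det.natAbs = Nat.card ((Fin n → ℤ) ⧸ N) := by
    rw [← Submodule.natAbs_det_equiv N e]
    congr 1
    rw [← LinearMap.det_toLin']
    rfl
  have hpos : Nat.card ((Fin n → ℤ) ⧸ N) ≠ 0 := by rw [← hcard]; exact Int.natAbs_ne_zero.mpr hdet
  have : Finite ((Fin n → ℤ) ⧸ N) := Nat.finite_of_card_ne_zero hpos
  have hdvd : ∀ q : ℤ, q • b ∈ N → T.det ∣ q := by
    rintro q ⟨u, hu⟩
    have h1 : T.adjugate.mulVec (T.mulVec u) = T.adjugate.mulVec (q • b) := by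
      rw [← hu]; rfl
    rw [Matrix.mulVec_mulVec, Matrix.adjugate_mul, Matrix.mulVec_smul, Matrix.smul_mulVec,
      Matrix.one_mulVec] at h1
    have h2 := congrFun h1 i₀
    rw [Pi.smul_apply, Pi.smul_apply, hb, smul_eq_mul, smul_eq_mul, mul_one] at h2
    exact ⟨u i₀, h2.symm⟩
  let β : (Fin n → ℤ) ⧸ N := Submodule.Quotient.mk b
  have hord : T.det.natAbs ∣ addOrderOf β := by
    rw [← Int.natCast_dvd_natCast, Int.natAbs_dvd]
    apply hdvd
    have h1 : addOrderOf β • β = 0 := addOrderOf_nsmul_eq_zero β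
    rw [← Submodule.Quotient.mk_eq_zero, Submodule.Quotient.mk_smul, natCast_zsmul]
    exact h1
  have htop : AddSubgroup.zmultiples β = ⊤ := by
    apply AddSubgroup.eq_top_of_le_card
    rw [Nat.card_zmultiples, ← hcard]
    exact Nat.le_of_dvd (addOrderOf_pos β) hord
  obtain ⟨q, hq⟩ := AddSubgroup.mem_zmultiples_iff.mp
    (htop ▸ AddSubgroup.mem_top (Submodule.Quotient.mk v : (Fin n → ℤ) ⧸ N))
  have hq' : (Submodule.Quotient.mk (q • b) : (Fin n → ℤ) ⧸ N) = Submodule.Quotient.mk v := by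
    rw [Submodule.Quotient.mk_smul]; exact hq
  rw [eq_comm, Submodule.Quotient.eq] at hq'
  obtain ⟨k, hk⟩ := hq'
  exact ⟨q, k, by rw [show T.mulVec k = v - q • b from hk]; abel⟩

/-! ### The matrices of an execution -/

/-- In each column the diagonal entry and the additions in the first column amount to at most
`n p ≤ p ^ j₀`, and there is at most one power `p ^ j i`. -/
theorem sum_constMatrix_le {n p j₀ : ℕ} {j : ℕ → ℕ} (hn : 2 ≤ n) (hp : 2 ≤ p)
    (hj : ∀ k, k + 2 ≤ n → j (k + 2) ≤ j₀) (hj₀ : j₀ = 2 * n - 2) (l : Fin n) :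
    ∑ k, |constMatrix n p (n - 1) (n - 1) j k l| ≤ 2 * (p : ℤ) ^ j₀ := by
  have h0 : ∀ k, |constMatrix n p (n - 1) (n - 1) j k l| ≤ (if k = l then (p : ℤ) else 0) +
      ((p : ℤ) - if k = ⟨0, by omega⟩ then (p : ℤ) else 0) +
      (if (l : ℕ) + 1 = k then (p : ℤ) ^ j₀ else 0) := by
    intro k
    rw [abs_of_nonneg (by simp only [constMatrix, Matrix.of_apply]; positivity)]
    simp only [constMatrix, Matrix.of_apply, Fin.ext_iff]
    refine add_le_add (add_le_add le_rfl ?_) ?_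
    · split_ifs <;> omega
    · by_cases h : 0 < (k : ℕ) ∧ (k : ℕ) ≤ n - 1 ∧ (l : ℕ) + 1 = k
      · rw [if_pos h, if_pos h.2.2]
        have := hj l (by omega)
        rw [show (l : ℕ) + 2 = k + 1 by omega] at this
        exact pow_le_pow_right₀ (by exact_mod_cast (by omega : 1 ≤ p)) this
      · rw [if_neg h]; positivity
  refine (Finset.sum_le_sum fun k _ => h0 k).trans ?_
  rw [Finset.sum_add_distrib, Finset.sum_add_distrib, Finset.sum_sub_distrib,
    Finset.sum_ite_eq' Finset.univ l, Finset.sum_ite_eq' Finset.univ (⟨0, by omega⟩ : Fin n)]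
  simp only [Finset.mem_univ, if_true, Finset.sum_const, Finset.card_univ, Fintype.card_fin,
    nsmul_eq_mul]
  have h1 : ∑ k : Fin n, (if (l : ℕ) + 1 = k then (p : ℤ) ^ j₀ else 0) ≤ (p : ℤ) ^ j₀ := by
    by_cases hl : (l : ℕ) + 1 < n
    · have : ∀ k : Fin n, ((l : ℕ) + 1 = k) = (k = ⟨(l : ℕ) + 1, hl⟩) := by
        intro k; simp only [Fin.ext_iff, eq_iff_iff]; omega
      simp only [this]
      rw [Finset.sum_ite_eq' Finset.univ (⟨(l : ℕ) + 1, hl⟩ : Fin n)]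
      simp
    · rw [Finset.sum_eq_zero]
      · positivity
      · intro k _
        rw [if_neg (by omega)]
  have h2 : (n : ℤ) * p ≤ (p : ℤ) ^ j₀ := by
    have h3 : n ≤ 2 ^ (j₀ - 1) := by
      have h4 : n - 1 < 2 ^ (n - 1) := Nat.lt_two_pow_self
      have h5 : 2 ^ (n - 1) ≤ 2 ^ (j₀ - 1) := Nat.pow_le_pow_right (by norm_num) (by omega)
      omega
    have h6 : n * p ≤ p ^ j₀ := by
      calc n * p ≤ 2 ^ (j₀ - 1) * p := by gcongr
        _ ≤ p ^ (j₀ - 1) * p := by gcongr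
        _ = p ^ j₀ := by rw [← pow_succ]; congr 1; omega
    exact_mod_cast h6
  linarith

namespace Execution

variable {n : ℕ} {hn : 2 ≤ n} {a : ℕ} {M : Matrix (Fin n) (Fin n) ℤ} (E : Execution hn a M)

theorem A_eq : E.A = constMatrix n E.p (n - 1) (n - 1) E.j := by
  have := map_eval_pencil M.adjugate (constMatrix n E.p (n - 1) (n - 1) E.j) 0
  rw [← finalMatrix_eq_pencil, zero_smul, zero_add] at this
  exact this

theorem M'_eq : E.M' = E.t • M.adjugate + E.A := by
  rw [A_eq]; exact newMatrix_eq hn M E.j a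

theorem mul_M' : M * E.M' = (E.t * M.det) • (1 : Matrix (Fin n) (Fin n) ℤ) + M * E.A := by
  rw [M'_eq, mul_add, Matrix.mul_smul, Matrix.mul_adjugate, smul_smul]

theorem abs_t_ge :
    (a : ℝ) ^ 2 * (2 * (bottomLeft hn M : ℝ) * n) ^ (3 * n) ≤ |(E.t : ℝ)| :=
  abs_substValue_ge hn M E.j
    (coprimePart_spec E.p_least.1.1 (detC_ne_zero (finalMatrix_invariant hn M E.j
      E.p_least.1.1.two_le E.j_least).1)).1

theorem abs_mul_A_le (hmax : ∀ i k, |M i k| ≤ bottomLeft hn M) (i k : Fin n) :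
    |(M * E.A) i k| ≤ 2 * bottomLeft hn M * (E.p : ℤ) ^ (2 * n - 2) := by
  have hp := E.p_least.1.1.two_le
  have hm : 0 ≤ bottomLeft hn M := (abs_nonneg _).trans (hmax i k)
  have hj : ∀ k, k + 2 ≤ n → E.j (k + 2) ≤ 2 * n - 2 := by
    intro k hk
    have := (loopInvariant_of_isLeast M E.j hp k hk (fun k' _ => E.j_least k')).2
    omega
  rw [Matrix.mul_apply]
  calc |∑ l, M i l * E.A l k| ≤ ∑ l, |M i l * E.A l k| := Finset.abs_sum_le_sum_abs _ _
    _ ≤ ∑ l, bottomLeft hn M * |E.A l k| := by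
        refine Finset.sum_le_sum fun l _ => ?_
        rw [abs_mul]
        exact mul_le_mul_of_nonneg_right (hmax i l) (abs_nonneg _)
    _ = bottomLeft hn M * ∑ l, |E.A l k| := by rw [Finset.mul_sum]
    _ ≤ bottomLeft hn M * (2 * (E.p : ℤ) ^ (2 * n - 2)) := by
        rw [A_eq]
        exact mul_le_mul_of_nonneg_left (sum_constMatrix_le hn hp hj rfl k) hm
    _ = _ := by ring

/-- The entries of `M A` are small against `2 m n`, where `m` is the largest entry of `M`. -/
theorem abs_mul_A_le' (hdet : M.det ≠ 0) (hmax : ∀ i k, |M i k| ≤ bottomLeft hn M) (i k : Fin n) :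
    8 * (n : ℝ) ^ 2 * |(((M * E.A) i k : ℤ) : ℝ)| ≤ (2 * (bottomLeft hn M : ℝ) * n) ^ (3 * n) := by
  have hm := bottomLeft_pos hn hdet hmax
  have h1 := E.abs_mul_A_le hmax i k
  have h2 := sq_least_prime_le hn hdet hmax E.p_least
  set m := bottomLeft hn M
  have h3 : (E.p : ℤ) ^ (2 * n - 2) ≤ (2 * m * n) ^ (3 * (n - 1)) := by
    rw [show 2 * n - 2 = 2 * (n - 1) by omega, pow_mul, pow_mul]
    exact pow_le_pow_left₀ (by positivity) h2 _
  have h4 : 8 * (n : ℤ) ^ 2 * |(M * E.A) i k| ≤ (2 * m * n) ^ (3 * n) := by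
    have hn' : (2 : ℤ) ≤ n := by exact_mod_cast hn
    have h5 : 16 * m * (n : ℤ) ^ 2 ≤ (2 * m * n) ^ 3 := by
      have h6 : m * 1 * (n : ℤ) ^ 2 * 2 ≤ m * m ^ 2 * n ^ 2 * n := by
        gcongr
        exact one_le_pow₀ hm
      calc 16 * m * (n : ℤ) ^ 2 = 8 * (m * 1 * (n : ℤ) ^ 2 * 2) := by ring
        _ ≤ 8 * (m * m ^ 2 * n ^ 2 * n) := by linarith
        _ = _ := by ring
    calc 8 * (n : ℤ) ^ 2 * |(M * E.A) i k|
        ≤ 8 * (n : ℤ) ^ 2 * (2 * m * (2 * m * n) ^ (3 * (n - 1))) := by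
          gcongr
          exact h1.trans (by gcongr)
      _ = 16 * m * (n : ℤ) ^ 2 * (2 * m * n) ^ (3 * (n - 1)) := by ring
      _ ≤ (2 * m * n) ^ 3 * (2 * m * n) ^ (3 * (n - 1)) := by gcongr
      _ = (2 * m * n) ^ (3 * n) := by rw [← pow_add]; congr 1; omega
  exact_mod_cast h4

/-- The vector `adj M' b` ends in `1`. -/
theorem adjugate_mulVec_b : E.M'.adjugate.mulVec E.b ⟨n - 1, by omega⟩ = 1 := by
  rw [← E.bezout]
  obtain ⟨k, rfl⟩ := Nat.exists_eq_add_of_le' hn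
  rw [Matrix.mulVec, dotProduct, Fin.sum_univ_succ, Fin.sum_univ_succ, Finset.sum_eq_zero]
  · simp only [b, adjLast₁, adjLast₂, M']
    simp
    rw [mul_comm, mul_comm E.b₂]
  · intro i _
    simp [b]

end Execution

/-! ### Fractional parts of the multiples of `T⁻¹ b` -/

theorem fracPart_sub_intCast_of_abs_lt {y : ℚ} (hy : |y| < 1 / 2) (k : ℤ) :
    fracPart (y - k) = y := by
  rw [abs_lt] at hy
  have h0 : ⌈y - 1 / 2⌉ = 0 := by
    rw [Int.ceil_eq_iff]
    constructor
    · push_cast; linarith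
    · push_cast; linarith
  rw [fracPart, show y - (k : ℚ) - 1 / 2 = (y - 1 / 2) - (k : ℚ) by ring, Int.ceil_sub_intCast, h0]
  push_cast
  ring

theorem fracPart_add_intCast (y : ℚ) (k : ℤ) : fracPart (y + k) = fracPart y := by
  rw [fracPart, fracPart, show y + (k : ℚ) - 1 / 2 = (y - 1 / 2) + (k : ℚ) by ring,
    Int.ceil_add_intCast]
  push_cast
  ring

theorem fracPart_neg_of_abs_lt {y : ℚ} (hy : |fracPart y| < 1 / 2) :
    fracPart (-y) = -fracPart y := by
  have h : -y = -fracPart y - (⌈y - 1 / 2⌉ : ℤ) := by rw [fracPart]; ring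
  rw [h, fracPart_sub_intCast_of_abs_lt (by rwa [abs_neg])]

theorem fracNorm_zero {s : ℝ≥0∞} (hs : 1 ≤ s) {n : ℕ} (x : Fin n → ℚ) : fracNorm s 0 x = 0 := by
  rw [fracNorm, lpNorm_eq_zero hs]
  ext i
  have : fracPart 0 = 0 := by simpa using fracPart_sub_intCast_of_abs_lt (y := 0) (by norm_num) 0
  simp [fracVec, this]

theorem fracNorm_neg {s : ℝ≥0∞} (hs : 1 ≤ s) {n : ℕ} {q : ℤ} {x : Fin n → ℚ}
    (h : fracNorm s q x < 1 / 2) : fracNorm s (-q) x = fracNorm s q x := by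
  have h1 : fracVec (-q) x = -fracVec q x := by
    ext i
    have h2 : |fracPart (q * x i)| < 1 / 2 := by
      have h3 := (abs_le_lpNorm hs (fun i => ((fracVec q x i : ℚ) : ℝ)) i).trans_lt h
      have h4 : ((|fracPart (q * x i)| : ℚ) : ℝ) < ((1 / 2 : ℚ) : ℝ) := by
        push_cast
        exact h3
      exact_mod_cast h4
    rw [fracVec, Pi.neg_apply, fracVec, ← fracPart_neg_of_abs_lt h2]
    congr 1
    push_cast
    ring
  rw [fracNorm, h1, fracNorm, ← lpNorm_neg hs]
  congr 1
  ext i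
  simp

section Lattice

-- `i₀` is the position where `adj T b` is `1`, so that `x i₀ = 1 / det T` for `x = T⁻¹ b`
variable {n : ℕ} {T : Matrix (Fin n) (Fin n) ℤ} {b : Fin n → ℤ} {x : Fin n → ℚ}

/-- The integer vector `T {q x}`, where `T x = b`. -/
def latticeVec (T : Matrix (Fin n) (Fin n) ℤ) (b : Fin n → ℤ) (x : Fin n → ℚ) (q : ℤ) :
    Fin n → ℤ :=
  q • b - T.mulVec fun i => ⌈q * x i - 1 / 2⌉

theorem intCast_mulVec {R : Type*} [CommRing R] (T : Matrix (Fin n) (Fin n) ℤ) (v : Fin n → ℤ) :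
    (T.map (Int.cast : ℤ → R)).mulVec (fun i => (v i : R)) = fun i => ((T.mulVec v i : ℤ) : R) := by
  ext i
  exact (RingHom.map_mulVec (Int.castRingHom R) T v i).symm

theorem mulVec_fracVec (hx : (T.map (Int.cast : ℤ → ℚ)).mulVec x = fun i => (b i : ℚ)) (q : ℤ) :
    (T.map (Int.cast : ℤ → ℚ)).mulVec (fracVec q x) = fun i => (latticeVec T b x q i : ℚ) := by
  have h : fracVec q x = (q : ℚ) • x - fun i => ((⌈q * x i - 1 / 2⌉ : ℤ) : ℚ) := rfl
  rw [h, Matrix.mulVec_sub, Matrix.mulVec_smul, hx, intCast_mulVec]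
  ext i
  simp [latticeVec]

theorem mul_mulVec_ratCast (M : Matrix (Fin n) (Fin n) ℤ) {z : Fin n → ℚ} {v : Fin n → ℤ}
    (hz : (T.map (Int.cast : ℤ → ℚ)).mulVec z = fun i => (v i : ℚ)) :
    ((M * T).map (Int.cast : ℤ → ℝ)).mulVec (fun i => ((z i : ℚ) : ℝ)) =
      fun i => ((M.mulVec v i : ℤ) : ℝ) := by
  have h1 : (T.map (Int.cast : ℤ → ℝ)).mulVec (fun i => ((z i : ℚ) : ℝ)) =
      fun i => ((v i : ℤ) : ℝ) := by
    ext i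
    have h3 := congrArg (Rat.castHom ℝ) (congrFun hz i)
    rw [RingHom.map_mulVec] at h3
    have e1 : (T.map (Int.cast : ℤ → ℚ)).map (Rat.castHom ℝ) = T.map (Int.cast : ℤ → ℝ) := by
      ext; simp
    rw [e1, map_intCast] at h3
    exact h3
  have h4 : (M * T).map (Int.cast : ℤ → ℝ) = M.map Int.cast * T.map Int.cast :=
    Matrix.map_mul (f := Int.castRingHom ℝ)
  rw [h4, ← Matrix.mulVec_mulVec, h1, intCast_mulVec]

/-- Every lattice vector `v` for which `T⁻¹ v` is short is of the form `T {q x}`. -/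
theorem exists_fracVec_eq (hdet : T.det ≠ 0)
    (hx : (T.map (Int.cast : ℤ → ℚ)).mulVec x = fun i => (b i : ℚ))
    {i₀ : Fin n} (hb : T.adjugate.mulVec b i₀ = 1) (v : Fin n → ℤ) {z : Fin n → ℚ}
    (hz : (T.map (Int.cast : ℤ → ℚ)).mulVec z = fun i => (v i : ℚ)) (hz2 : ∀ i, |z i| < 1 / 2) :
    ∃ q : ℤ, fracVec q x = z := by
  obtain ⟨q, k, hv⟩ := exists_eq_smul_add_mulVec hdet hb v
  have hdetQ : (T.map (Int.cast : ℤ → ℚ)).det ≠ 0 := by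
    have : (T.map (Int.cast : ℤ → ℚ)).det = T.det := (RingHom.map_det (Int.castRingHom ℚ) T).symm
    rw [this]
    exact_mod_cast hdet
  have hzk : z = (q : ℚ) • x + fun i => (k i : ℚ) := by
    apply Matrix.mulVec_injective_of_det_ne_zero hdetQ
    rw [hz, Matrix.mulVec_add, Matrix.mulVec_smul, hx, intCast_mulVec, hv]
    ext i
    simp
  refine ⟨q, ?_⟩
  ext i
  have h1 : (q : ℚ) * x i = z i - (k i : ℤ) := by rw [hzk]; simp
  rw [fracVec, h1, fracPart_sub_intCast_of_abs_lt (hz2 i)]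

theorem det_smul_eq (hx : (T.map (Int.cast : ℤ → ℚ)).mulVec x = fun i => (b i : ℚ)) (i : Fin n) :
    (T.det : ℚ) * x i = (T.adjugate.mulVec b i : ℤ) := by
  have h1 : (T.adjugate.map (Int.cast : ℤ → ℚ)) * T.map (Int.cast : ℤ → ℚ) =
      (T.adjugate * T).map (Int.cast : ℤ → ℚ) :=
    (Matrix.map_mul (f := Int.castRingHom ℚ)).symm
  have h2 := congrArg ((T.adjugate.map (Int.cast : ℤ → ℚ)).mulVec) hx
  rw [Matrix.mulVec_mulVec, h1, Matrix.adjugate_mul, intCast_mulVec] at h2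
  have h3 : (T.det • (1 : Matrix (Fin n) (Fin n) ℤ)).map (Int.cast : ℤ → ℚ) =
      (T.det : ℚ) • (1 : Matrix (Fin n) (Fin n) ℚ) := by
    ext r s
    rw [Matrix.map_apply, Matrix.smul_apply, Matrix.smul_apply, Matrix.one_apply, Matrix.one_apply,
      smul_eq_mul, smul_eq_mul, Int.cast_mul]
    split_ifs <;> simp only [Int.cast_one, Int.cast_zero]
  rw [h3, Matrix.smul_mulVec, Matrix.one_mulVec] at h2
  exact congrFun h2 i

theorem fracVec_sub_mul_det (hx : (T.map (Int.cast : ℤ → ℚ)).mulVec x = fun i => (b i : ℚ))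
    (q k : ℤ) : fracVec (q - k * T.det) x = fracVec q x := by
  ext i
  rw [fracVec, fracVec]
  have h := det_smul_eq hx i
  have : ((q - k * T.det : ℤ) : ℚ) * x i = q * x i + ((-k * T.adjugate.mulVec b i : ℤ) : ℚ) := by
    simp only [Int.cast_sub, Int.cast_mul, Int.cast_neg, ← h]
    ring
  rw [this, fracPart_add_intCast]

theorem fracNorm_sub_mul_det (hx : (T.map (Int.cast : ℤ → ℚ)).mulVec x = fun i => (b i : ℚ))
    (s : ℝ≥0∞) (q k : ℤ) : fracNorm s (q - k * T.det) x = fracNorm s q x := by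
  rw [fracNorm, fracVec_sub_mul_det hx, fracNorm]

/-- If some multiple of `x` is not integral, the simultaneous approximation problem has a solution,
since the fractional parts of the multiples form a finite set. -/
theorem exists_isSAPSolution (hdet : T.det ≠ 0)
    (hx : (T.map (Int.cast : ℤ → ℚ)).mulVec x = fun i => (b i : ℚ)) {s : ℝ≥0∞}
    {q₁ : ℤ} (hq₁ : 0 < fracNorm s q₁ x) {α : ℝ} (hα : 1 ≤ α) :
    ∃ q, IsSAPSolution s ⟨α, x⟩ q := by
  have hmod : ∀ q, fracNorm s (q % T.det) x = fracNorm s q x := by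
    intro q
    rw [Int.emod_def, mul_comm, fracNorm_sub_mul_det hx]
  let S : Set ℤ := {r | r ∈ Set.Ico 0 |T.det| ∧ 0 < fracNorm s r x}
  have hmem : ∀ q, 0 < fracNorm s q x → q % T.det ∈ S := fun q hq =>
    ⟨⟨Int.emod_nonneg q hdet, Int.emod_lt_abs q hdet⟩, by rwa [hmod]⟩
  have hfin : S.Finite := (Set.finite_Ico 0 |T.det|).subset fun r hr => hr.1
  obtain ⟨r, hr, hmin⟩ := Set.exists_min_image S (fun r => fracNorm s r x) hfin
    ⟨_, hmem q₁ hq₁⟩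
  refine ⟨r, hr.2, fun q hq => ?_⟩
  have h1 := hmin _ (hmem q hq)
  rw [hmod] at h1
  change fracNorm s r x ≤ α * fracNorm s q x
  nlinarith [hr.2]

/-- A multiple of `x` that is close to an integer vector is one by a small factor, up to sign,
because the coordinate `i₀` of `x` is `1 / det T`. -/
theorem exists_small_multiple (hdet : T.det ≠ 0)
    (hx : (T.map (Int.cast : ℤ → ℚ)).mulVec x = fun i => (b i : ℚ))
    {i₀ : Fin n} (hb : T.adjugate.mulVec b i₀ = 1) {s : ℝ≥0∞} (hs : 1 ≤ s) {q : ℤ} {η : ℝ}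
    (hq : 0 < fracNorm s q x) (hqη : fracNorm s q x ≤ η) (hη : η < 1 / 2) :
    ∃ r : ℤ, 1 ≤ r ∧ (r : ℝ) ≤ η * |(T.det : ℝ)| ∧ fracNorm s r x = fracNorm s q x := by
  have hdetQ : (T.det : ℚ) ≠ 0 := by exact_mod_cast hdet
  have h1 := det_smul_eq hx i₀
  rw [hb] at h1
  set k := ⌈(q : ℚ) * x i₀ - 1 / 2⌉ with hk
  have hr : ((q - k * T.det : ℤ) : ℚ) = T.det * fracVec q x i₀ := by
    rw [fracVec, fracPart, ← hk]
    simp only [Int.cast_sub, Int.cast_mul]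
    rw [Int.cast_one] at h1
    linear_combination (-(q : ℚ)) * h1
  have hrR : ((q - k * T.det : ℤ) : ℝ) = T.det * ((fracVec q x i₀ : ℚ) : ℝ) := by
    have := congrArg (Rat.cast : ℚ → ℝ) hr
    rwa [Rat.cast_mul, Rat.cast_intCast, Rat.cast_intCast] at this
  have habs : |((q - k * T.det : ℤ) : ℝ)| ≤ η * |(T.det : ℝ)| := by
    rw [hrR, abs_mul, mul_comm]
    exact mul_le_mul_of_nonneg_right
      ((abs_le_lpNorm hs (fun i => ((fracVec q x i : ℚ) : ℝ)) i₀).trans hqη) (abs_nonneg _)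
  have hnorm := fracNorm_sub_mul_det hx s q k
  set r := q - k * T.det
  have hr0 : r ≠ 0 := by
    intro h0
    rw [h0, fracNorm_zero hs] at hnorm
    exact hq.ne hnorm
  rcases lt_or_gt_of_ne hr0 with hneg | hpos
  · refine ⟨-r, by omega, ?_, ?_⟩
    · rw [Int.cast_neg]
      exact (neg_le_abs _).trans habs
    · rw [fracNorm_neg hs (by rw [hnorm]; linarith), hnorm]
  · exact ⟨r, by omega, (le_abs_self _).trans habs, hnorm⟩

theorem fracNorm_pos_of_lt
    (hx : (T.map (Int.cast : ℤ → ℚ)).mulVec x = fun i => (b i : ℚ))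
    {i₀ : Fin n} (hb : T.adjugate.mulVec b i₀ = 1) {s : ℝ≥0∞} (hs : 1 ≤ s) {q : ℤ}
    (hq : 1 ≤ q) (hq' : q < |T.det|) : 0 < fracNorm s q x := by
  rw [fracNorm, lpNorm_pos hs]
  intro h0
  have h1 := det_smul_eq hx i₀
  rw [hb] at h1
  have h2 : fracVec q x i₀ = 0 := Rat.cast_eq_zero.mp (congrFun h0 i₀)
  rw [fracVec, fracPart, sub_eq_zero] at h2
  set k := ⌈(q : ℚ) * x i₀ - 1 / 2⌉
  have h3 : (q : ℚ) = T.det * k := by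
    rw [← h2]
    rw [Int.cast_one] at h1
    linear_combination (-(q : ℚ)) * h1
  have h4 : T.det ∣ q := ⟨k, by rw [← Int.cast_mul] at h3; exact Int.cast_injective h3⟩
  have h5 := Int.le_of_dvd (by omega) ((abs_dvd _ _).mpr h4)
  omega

end Lattice

/-! ### From good fractional parts to short lattice vectors -/

/-- For `ε ≤ 1 / 16` the square of the distortion `(1 + ε) / (1 - ε)` is below `1 + 8 ε`. -/
theorem distortion_sq_lt {ε : ℝ} (h0 : 0 < ε) (h1 : ε ≤ 1 / 16) :
    ((1 + ε) / (1 - ε)) ^ 2 < 1 + 8 * ε := by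
  have h2 : 0 < 1 - ε := by linarith
  rw [div_pow, div_lt_iff₀ (by positivity)]
  have h3 : 0 < ε * (1 / 4 - ε) := mul_pos h0 (by linarith)
  have h4 : 0 < ε ^ 3 := by positivity
  nlinarith

theorem lpNorm_bounds_of_eq_smul_one_add {s : ℝ≥0∞} (hs : 1 ≤ s) {n : ℕ}
    {P B : Matrix (Fin n) (Fin n) ℤ} {w : ℤ} (hP : P = w • (1 : Matrix (Fin n) (Fin n) ℤ) + B)
    {ε : ℝ} (hB : ∀ u : Fin n → ℝ,
      lpNorm s ((B.map (Int.cast : ℤ → ℝ)).mulVec u) ≤ ε * |(w : ℝ)| * lpNorm s u)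
    (u : Fin n → ℝ) :
    (1 - ε) * |(w : ℝ)| * lpNorm s u ≤ lpNorm s ((P.map (Int.cast : ℤ → ℝ)).mulVec u) ∧
      lpNorm s ((P.map (Int.cast : ℤ → ℝ)).mulVec u) ≤ (1 + ε) * |(w : ℝ)| * lpNorm s u := by
  have h1 : (P.map (Int.cast : ℤ → ℝ)).mulVec u =
      (w : ℝ) • u + (B.map (Int.cast : ℤ → ℝ)).mulVec u := by
    have : P.map (Int.cast : ℤ → ℝ) =
        (w : ℝ) • (1 : Matrix (Fin n) (Fin n) ℝ) + B.map (Int.cast : ℤ → ℝ) := by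
      rw [hP]
      ext r l
      rw [Matrix.map_apply, Matrix.add_apply, Matrix.add_apply, Matrix.smul_apply,
        Matrix.smul_apply, Matrix.one_apply, Matrix.one_apply, Matrix.map_apply, smul_eq_mul,
        smul_eq_mul, Int.cast_add, Int.cast_mul]
      split_ifs <;> simp only [Int.cast_one, Int.cast_zero]
    rw [this, Matrix.add_mulVec, Matrix.smul_mulVec, Matrix.one_mulVec]
  have h2 := lpNorm_add_le hs ((w : ℝ) • u) ((B.map (Int.cast : ℤ → ℝ)).mulVec u)
  have h3 := lpNorm_sub_le hs ((w : ℝ) • u) ((B.map (Int.cast : ℤ → ℝ)).mulVec u)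
  rw [lpNorm_smul hs] at h2 h3
  rw [h1]
  have h4 := hB u
  constructor <;> linarith

theorem latNorm_pos {s : ℝ≥0∞} (hs : 1 ≤ s) {n : ℕ} {M : Matrix (Fin n) (Fin n) ℤ}
    (hdet : M.det ≠ 0) {v : Fin n → ℤ} (hv : v ≠ 0) : 0 < latNorm s M v := by
  rw [latNorm, lpNorm_pos hs]
  intro h
  apply hv
  apply Matrix.mulVec_injective_of_det_ne_zero hdet
  rw [Matrix.mulVec_zero]
  ext i
  exact Int.cast_eq_zero.mp (congrFun h i)

section Core

-- `W` stands for the scale `|t det M|` of `M T`, and `ρ` for `|det M| ^ (1 / n)`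
variable {s : ℝ≥0∞} {n a : ℕ} {M T : Matrix (Fin n) (Fin n) ℤ} {b : Fin n → ℤ} {x : Fin n → ℚ}
  {W ρ ε : ℝ}

/-- A vector of the lattice of `M` within Minkowski's bound comes from a small `{q x}`. -/
theorem exists_short_multiple (hs : s = 1 ∨ s = 2 ∨ s = ∞) (hn : 1 ≤ n) (ha : 1 ≤ a)
    (hT : T.det ≠ 0) (hx : (T.map (Int.cast : ℤ → ℚ)).mulVec x = fun i => (b i : ℚ))
    {i₀ : Fin n} (hb : T.adjugate.mulVec b i₀ = 1) (hρ : 1 ≤ ρ) (hW : 8 * a * n * ρ ≤ W)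
    (hε : ε ≤ 1 / 16)
    (hlow : ∀ u : Fin n → ℝ, (1 - ε) * W * lpNorm s u ≤
      lpNorm s (((M * T).map (Int.cast : ℤ → ℝ)).mulVec u))
    {u : Fin n → ℤ} (hu : 0 < latNorm s M u) (hu' : latNorm s M u ≤ (n : ℝ) ^ (s⁻¹).toReal * ρ) :
    ∃ q, 0 < fracNorm s q x ∧ fracNorm s q x ≤ 1 / (4 * a) ∧
      (1 - ε) * W * fracNorm s q x ≤ latNorm s M u := by
  have hs1 := one_le_of_mem hs
  have ha' : (1 : ℝ) ≤ a := by exact_mod_cast ha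
  have hn' : (1 : ℝ) ≤ n := by exact_mod_cast hn
  have hTQ : (T.map (Int.cast : ℤ → ℚ)).det ≠ 0 := by
    have : (T.map (Int.cast : ℤ → ℚ)).det = T.det := (RingHom.map_det (Int.castRingHom ℚ) T).symm
    rw [this]
    exact_mod_cast hT
  set z : Fin n → ℚ := (T.map (Int.cast : ℤ → ℚ))⁻¹.mulVec fun i => (u i : ℚ) with hz
  have hTz : (T.map (Int.cast : ℤ → ℚ)).mulVec z = fun i => (u i : ℚ) := by
    rw [hz, Matrix.mulVec_mulVec, Matrix.mul_nonsing_inv _ (isUnit_iff_ne_zero.mpr hTQ),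
      Matrix.one_mulVec]
  have hMz := mul_mulVec_ratCast M hTz
  have hzlow := hlow fun i => ((z i : ℚ) : ℝ)
  rw [hMz] at hzlow
  change _ ≤ latNorm s M u at hzlow
  set ζ := lpNorm s fun i => ((z i : ℚ) : ℝ) with hζ
  have hζ0 : 0 ≤ ζ := lpNorm_nonneg hs1 _
  have hζ4 : ζ ≤ 1 / (4 * a) := by
    rw [le_div_iff₀ (by positivity)]
    have h1 : latNorm s M u ≤ n * ρ := hu'.trans (by gcongr; exact rpow_inv_le hs hn)
    have h2 : (1 / 2 : ℝ) * (8 * a * n * ρ) * ζ ≤ (1 - ε) * W * ζ :=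
      mul_le_mul_of_nonneg_right
        (mul_le_mul (by linarith) hW (by positivity) (by linarith)) hζ0
    have h3 : (n * ρ) * (ζ * (4 * a)) ≤ (n * ρ) * 1 := by linarith
    exact le_of_mul_le_mul_left h3 (by positivity)
  have hz2 : ∀ i, |z i| < 1 / 2 := by
    intro i
    have h1 : |((z i : ℚ) : ℝ)| ≤ 1 / (4 * a) :=
      (abs_le_lpNorm hs1 (fun i => ((z i : ℚ) : ℝ)) i).trans hζ4
    have h2 : (1 : ℝ) / (4 * a) < 1 / 2 := by
      apply one_div_lt_one_div_of_lt <;> linarith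
    have h3 : ((|z i| : ℚ) : ℝ) < ((1 / 2 : ℚ) : ℝ) := by
      push_cast
      linarith
    exact_mod_cast h3
  obtain ⟨q, hq⟩ := exists_fracVec_eq hT hx hb u hTz hz2
  have hqζ : fracNorm s q x = ζ := by rw [fracNorm, hq]
  refine ⟨q, ?_, by rwa [hqζ], by rwa [hqζ]⟩
  rw [hqζ]
  refine lt_of_le_of_ne hζ0 fun h0 => ?_
  have h1 := (lpNorm_eq_zero hs1).mp h0.symm
  rw [h1, Matrix.mulVec_zero] at hMz
  rw [latNorm, ← hMz, (lpNorm_eq_zero hs1).mpr rfl] at hu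
  exact hu.false

/-- If `{q₀ x}` is shortest up to the factor `a / d` among the short vectors `{q x}`, then
`T {q₀ x}` solves the short vector problem, with the same factor: `M T` distorts norms so little
that the discreteness of the norms of integer vectors absorbs the distortion. -/
theorem isSVPSolution_latticeVec (hs : s = 1 ∨ s = 2 ∨ s = ∞) (hn : 1 ≤ n) {d : ℕ} (hd : 0 < d)
    (ha : 1 ≤ a) (hM : M.det ≠ 0)
    (hT : T.det ≠ 0) (hx : (T.map (Int.cast : ℤ → ℚ)).mulVec x = fun i => (b i : ℚ))
    {i₀ : Fin n} (hb : T.adjugate.mulVec b i₀ = 1) (hρ : 1 ≤ ρ)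
    (hmink : ∃ v : Fin n → ℤ, v ≠ 0 ∧ ∀ i, |((M.mulVec v i : ℤ) : ℝ)| ≤ ρ)
    (hW : 8 * a * n * ρ ≤ W) (hε : ε = 1 / (8 * (a ^ 2 * n * ρ ^ 2))) (hε16 : ε ≤ 1 / 16)
    (hbd : ∀ u : Fin n → ℝ,
      (1 - ε) * W * lpNorm s u ≤ lpNorm s (((M * T).map (Int.cast : ℤ → ℝ)).mulVec u) ∧
      lpNorm s (((M * T).map (Int.cast : ℤ → ℝ)).mulVec u) ≤ (1 + ε) * W * lpNorm s u)
    {q₀ : ℤ} (hq₀ : 0 < fracNorm s q₀ x)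
    (hopt : ∀ q, 0 < fracNorm s q x → fracNorm s q x ≤ 1 / (4 * a) →
      fracNorm s q₀ x ≤ (a : ℝ) / d * fracNorm s q x) :
    IsSVPSolution s ((a : ℝ) / d) M (latticeVec T b x q₀) := by
  have hs1 := one_le_of_mem hs
  have ha' : (1 : ℝ) ≤ a := by exact_mod_cast ha
  have hn' : (1 : ℝ) ≤ n := by exact_mod_cast hn
  have hd' : (0 : ℝ) < d := by exact_mod_cast hd
  have hε0 : 0 < ε := by rw [hε]; positivity
  have hW0 : 0 < W := lt_of_lt_of_le (by positivity) hW
  have hval : ∀ q, latNorm s M (latticeVec T b x q) =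
      lpNorm s (((M * T).map (Int.cast : ℤ → ℝ)).mulVec
        (fun i => ((fracVec q x i : ℚ) : ℝ))) := by
    intro q
    rw [mul_mulVec_ratCast M (mulVec_fracVec hx q)]
    rfl
  have hshort : ∀ u : Fin n → ℤ, 0 < latNorm s M u →
      latNorm s M u ≤ (n : ℝ) ^ (s⁻¹).toReal * ρ →
      d * latNorm s M (latticeVec T b x q₀) ≤ a * latNorm s M u := by
    intro u hu hu'
    obtain ⟨q, hq0, hq4, hqu⟩ := exists_short_multiple hs hn ha hT hx hb hρ hW hε16
      (fun u => (hbd u).1) hu hu'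
    refine mul_lpNorm_le_of_sq_lt hs hn ha _ _ hρ hu' ?_
    change (d * latNorm s M (latticeVec T b x q₀)) ^ 2 <
      (a * latNorm s M u) ^ 2 + latNorm s M u ^ 2 / (n * ρ ^ 2)
    have h1 : d * latNorm s M (latticeVec T b x q₀) ≤ (1 + ε) / (1 - ε) * (a * latNorm s M u) := by
      have h2 := (hbd fun i => ((fracVec q₀ x i : ℚ) : ℝ)).2
      rw [← hval] at h2
      change _ ≤ _ * fracNorm s q₀ x at h2
      have h3 := hopt q hq0 hq4
      rw [div_mul_eq_mul_div, le_div_iff₀ hd'] at h3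
      have h4 : 0 < 1 - ε := by linarith
      rw [div_mul_eq_mul_div, le_div_iff₀ h4]
      calc d * latNorm s M (latticeVec T b x q₀) * (1 - ε)
          ≤ d * ((1 + ε) * W * fracNorm s q₀ x) * (1 - ε) := by gcongr
        _ = (1 + ε) * (1 - ε) * W * (fracNorm s q₀ x * d) := by ring
        _ ≤ (1 + ε) * (1 - ε) * W * (a * fracNorm s q x) := by gcongr
        _ = (1 + ε) * (a * ((1 - ε) * W * fracNorm s q x)) := by ring
        _ ≤ (1 + ε) * (a * latNorm s M u) := by gcongr
    have h0 : 0 ≤ latNorm s M (latticeVec T b x q₀) := lpNorm_nonneg hs1 _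
    calc (d * latNorm s M (latticeVec T b x q₀)) ^ 2
        ≤ ((1 + ε) / (1 - ε) * (a * latNorm s M u)) ^ 2 := pow_le_pow_left₀ (by positivity) h1 2
      _ = ((1 + ε) / (1 - ε)) ^ 2 * (a * latNorm s M u) ^ 2 := mul_pow _ _ _
      _ < (1 + 8 * ε) * (a * latNorm s M u) ^ 2 := by
          have := distortion_sq_lt hε0 hε16
          gcongr
      _ = _ := by rw [hε]; field_simp
  obtain ⟨v, hv0, hv⟩ := hmink
  have hvpos := latNorm_pos hs1 hM hv0
  have hvle := lpNorm_le_of_forall hs (by linarith : (0 : ℝ) ≤ ρ) hv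
  refine ⟨?_, fun u hu => ?_⟩
  · rw [hval]
    refine lt_of_lt_of_le ?_ (hbd _).1
    exact mul_pos (mul_pos (by linarith) hW0) hq₀
  · rw [div_mul_eq_mul_div, le_div_iff₀ hd', mul_comm]
    rcases le_total (latNorm s M u) ((n : ℝ) ^ (s⁻¹).toReal * ρ) with h | h
    · exact hshort u hu h
    · exact (hshort v hvpos hvle).trans (by gcongr; exact hvle.trans h)

end Core

namespace Execution

variable {n : ℕ} {hn : 2 ≤ n} {a : ℕ} {M : Matrix (Fin n) (Fin n) ℤ} (E : Execution hn a M)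

/-! ### The estimates for an execution -/

theorem eight_mul_le_pow {m n : ℝ} (hm : 1 ≤ m) {k : ℕ} (hn : n = k) (hk : 2 ≤ k) :
    8 * m * n ≤ (2 * m * n) ^ (3 * k) := by
  have hn2 : 2 ≤ n := by rw [hn]; exact_mod_cast hk
  have h4 : 4 ≤ 2 * m * n := by nlinarith
  calc 8 * m * n ≤ (2 * m * n) ^ 2 := by nlinarith
    _ ≤ (2 * m * n) ^ (3 * k) := pow_le_pow_right₀ (by linarith) (by omega)

/-- The bound `ε` for the operator norm of `M A` relative to `|t det M|`. It is chosen such that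
`1 + 8 ε = 1 + 1 / (a² n |det M| ^ (2 / n))` is the square of the distortion that is allowed. -/
noncomputable def eps {n : ℕ} (a : ℕ) (M : Matrix (Fin n) (Fin n) ℤ) : ℝ :=
  1 / (8 * ((a : ℝ) ^ 2 * n * (|(M.det : ℝ)| ^ (1 / (n : ℝ))) ^ 2))

theorem one_le_root_det (hdet : M.det ≠ 0) : 1 ≤ |(M.det : ℝ)| ^ (1 / (n : ℝ)) := by
  have : (1 : ℤ) ≤ |M.det| := Int.one_le_abs hdet
  exact Real.one_le_rpow (by exact_mod_cast this) (by positivity)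

theorem root_det_pow_le (hn : 2 ≤ n) (hdet : M.det ≠ 0) {k : ℕ} (hk : k ≤ 2) :
    (|(M.det : ℝ)| ^ (1 / (n : ℝ))) ^ k ≤ |(M.det : ℝ)| := by
  have hn0 : (n : ℝ) ≠ 0 := by positivity
  calc (|(M.det : ℝ)| ^ (1 / (n : ℝ))) ^ k ≤ (|(M.det : ℝ)| ^ (1 / (n : ℝ))) ^ n :=
        pow_le_pow_right₀ (one_le_root_det hdet) (by omega)
    _ = |(M.det : ℝ)| := by
        rw [← Real.rpow_natCast, ← Real.rpow_mul (abs_nonneg _), one_div_mul_cancel hn0,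
          Real.rpow_one]

theorem eps_pos (hn : 2 ≤ n) (ha : 1 ≤ a) (hdet : M.det ≠ 0) : 0 < eps a M := by
  have hρ := one_le_root_det hdet
  have ha' : (1 : ℝ) ≤ a := by exact_mod_cast ha
  have hn' : (2 : ℝ) ≤ n := by exact_mod_cast hn
  unfold eps
  positivity

theorem eps_le (hn : 2 ≤ n) (ha : 1 ≤ a) (hdet : M.det ≠ 0) : eps a M ≤ 1 / 16 := by
  have hρ := one_le_root_det hdet
  have ha' : (1 : ℝ) ≤ a := by exact_mod_cast ha
  have hn' : (2 : ℝ) ≤ n := by exact_mod_cast hn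
  have h1 : 1 * 2 * 1 ≤ (a : ℝ) ^ 2 * n * (|(M.det : ℝ)| ^ (1 / (n : ℝ))) ^ 2 := by
    gcongr
    · exact one_le_pow₀ ha'
    · exact one_le_pow₀ hρ
  unfold eps
  apply one_div_le_one_div_of_le <;> linarith

theorem abs_scale_ge :
    (a : ℝ) ^ 2 * (2 * (bottomLeft hn M : ℝ) * n) ^ (3 * n) * |(M.det : ℝ)| ≤
      |((E.t * M.det : ℤ) : ℝ)| := by
  rw [Int.cast_mul, abs_mul]
  exact mul_le_mul_of_nonneg_right E.abs_t_ge (abs_nonneg _)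

theorem abs_scale_ge' (ha : 1 ≤ a) (hdet : M.det ≠ 0)
    (hmax : ∀ i k, |M i k| ≤ bottomLeft hn M) :
    8 * a * n * |(M.det : ℝ)| ^ (1 / (n : ℝ)) ≤ |((E.t * M.det : ℤ) : ℝ)| := by
  have hm : (1 : ℝ) ≤ bottomLeft hn M := by exact_mod_cast bottomLeft_pos hn hdet hmax
  have ha' : (1 : ℝ) ≤ a := by exact_mod_cast ha
  have hρ := root_det_pow_le hn hdet (k := 1) (by norm_num)
  rw [pow_one] at hρ
  refine le_trans ?_ E.abs_scale_ge
  have h1 := eight_mul_le_pow hm rfl hn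
  calc 8 * a * n * |(M.det : ℝ)| ^ (1 / (n : ℝ))
      ≤ 8 * a * n * |(M.det : ℝ)| := by gcongr
    _ = a * (8 * 1 * n) * |(M.det : ℝ)| := by ring
    _ ≤ a ^ 2 * (8 * bottomLeft hn M * n) * |(M.det : ℝ)| := by
        gcongr
        nlinarith
    _ ≤ _ := by gcongr

theorem lpNorm_mul_A_le {s : ℝ≥0∞} (hs : s = 1 ∨ s = 2 ∨ s = ∞) (ha : 1 ≤ a) (hdet : M.det ≠ 0)
    (hmax : ∀ i k, |M i k| ≤ bottomLeft hn M) (u : Fin n → ℝ) :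
    lpNorm s (((M * E.A).map (Int.cast : ℤ → ℝ)).mulVec u) ≤
      eps a M * |((E.t * M.det : ℤ) : ℝ)| * lpNorm s u := by
  have hm : (1 : ℝ) ≤ bottomLeft hn M := by exact_mod_cast bottomLeft_pos hn hdet hmax
  have ha' : (1 : ℝ) ≤ a := by exact_mod_cast ha
  have hn' : (2 : ℝ) ≤ n := by exact_mod_cast hn
  have hρ1 := one_le_root_det hdet
  have hρ2 := root_det_pow_le hn hdet (k := 2) le_rfl
  set X := (2 * (bottomLeft hn M : ℝ) * n) ^ (3 * n) with hX
  have hX0 : 0 ≤ X := by positivity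
  have hentry : ∀ i k, |((M * E.A).map (Int.cast : ℤ → ℝ)) i k| ≤ X / (8 * n ^ 2) := by
    intro i k
    rw [le_div_iff₀ (by positivity), mul_comm]
    exact E.abs_mul_A_le' hdet hmax i k
  refine (lpNorm_mulVec_le hs (by positivity) hentry u).trans ?_
  refine mul_le_mul_of_nonneg_right ?_ (lpNorm_nonneg (one_le_of_mem hs) u)
  have heps := eps_pos hn ha hdet
  calc n * (X / (8 * n ^ 2)) = X / (8 * n) := by field_simp
    _ = eps a M * (a ^ 2 * X * (|(M.det : ℝ)| ^ (1 / (n : ℝ))) ^ 2) := by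
        unfold eps
        field_simp
    _ ≤ eps a M * (a ^ 2 * X * |(M.det : ℝ)|) := by gcongr
    _ ≤ _ := by
        gcongr
        exact E.abs_scale_ge

theorem isNearlyScaledOrthonormal {s : ℝ≥0∞} (hs : s = 1 ∨ s = 2 ∨ s = ∞) (ha : 1 ≤ a)
    (hdet : M.det ≠ 0) (hmax : ∀ i k, |M i k| ≤ bottomLeft hn M) :
    IsNearlyScaledOrthonormal s a |(M.det : ℝ)| (E.t * M.det) (M * E.A) := by
  have h0 := eps_pos hn ha hdet
  have h1 := eps_le hn ha hdet
  refine ⟨eps a M, h0.le, by linarith, E.lpNorm_mul_A_le hs ha hdet hmax, ?_⟩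
  have ha' : (1 : ℝ) ≤ a := by exact_mod_cast ha
  have hn' : (2 : ℝ) ≤ n := by exact_mod_cast hn
  have hρ1 := one_le_root_det hdet
  have hpow : |(M.det : ℝ)| ^ (2 / (n : ℝ)) = (|(M.det : ℝ)| ^ (1 / (n : ℝ))) ^ 2 := by
    rw [← Real.rpow_natCast, ← Real.rpow_mul (abs_nonneg _)]
    congr 1
    push_cast
    ring
  have hlt := distortion_sq_lt h0 h1
  rw [hpow, le_div_iff₀ (by positivity)]
  apply Real.le_sqrt_of_sq_le
  rw [mul_pow, mul_pow, mul_pow, Real.sq_sqrt (by positivity)]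
  calc ((1 + eps a M) / (1 - eps a M)) ^ 2 *
        ((a : ℝ) ^ 2 * n * (|(M.det : ℝ)| ^ (1 / (n : ℝ))) ^ 2)
      ≤ (1 + 8 * eps a M) * ((a : ℝ) ^ 2 * n * (|(M.det : ℝ)| ^ (1 / (n : ℝ))) ^ 2) := by gcongr
    _ = _ := by
        unfold eps
        field_simp

theorem lpNorm_bounds {s : ℝ≥0∞} (hs : s = 1 ∨ s = 2 ∨ s = ∞) (ha : 1 ≤ a)
    (hdet : M.det ≠ 0) (hmax : ∀ i k, |M i k| ≤ bottomLeft hn M) (u : Fin n → ℝ) :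
    (1 - eps a M) * |((E.t * M.det : ℤ) : ℝ)| * lpNorm s u ≤
        lpNorm s (((M * E.M').map (Int.cast : ℤ → ℝ)).mulVec u) ∧
      lpNorm s (((M * E.M').map (Int.cast : ℤ → ℝ)).mulVec u) ≤
        (1 + eps a M) * |((E.t * M.det : ℤ) : ℝ)| * lpNorm s u :=
  lpNorm_bounds_of_eq_smul_one_add (one_le_of_mem hs) E.mul_M'
    (E.lpNorm_mul_A_le hs ha hdet hmax) u

theorem abs_scale_pos (ha : 1 ≤ a) (hdet : M.det ≠ 0)
    (hmax : ∀ i k, |M i k| ≤ bottomLeft hn M) : 0 < |((E.t * M.det : ℤ) : ℝ)| := by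
  have hρ1 := one_le_root_det hdet
  have ha' : (1 : ℝ) ≤ a := by exact_mod_cast ha
  have hn' : (2 : ℝ) ≤ n := by exact_mod_cast hn
  exact lt_of_lt_of_le (by positivity) (E.abs_scale_ge' ha hdet hmax)

theorem det_M'_ne_zero (ha : 1 ≤ a) (hdet : M.det ≠ 0)
    (hmax : ∀ i k, |M i k| ≤ bottomLeft hn M) : E.M'.det ≠ 0 := by
  intro h0
  obtain ⟨v, hv0, hv⟩ := Matrix.exists_mulVec_eq_zero_iff.mpr h0
  have h1 := (E.lpNorm_bounds (s := 1) (Or.inl rfl) ha hdet hmax fun i => (v i : ℝ)).1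
  rw [intCast_mulVec, ← Matrix.mulVec_mulVec, hv, Matrix.mulVec_zero] at h1
  have h2 : lpNorm 1 (fun i : Fin n => (((0 : Fin n → ℤ) i : ℤ) : ℝ)) = 0 :=
    (lpNorm_eq_zero le_rfl).mpr (by ext i; simp)
  rw [h2] at h1
  have h3 : 0 < lpNorm 1 fun i => (v i : ℝ) := by
    rw [lpNorm_pos le_rfl]
    intro h
    apply hv0
    ext i
    exact Int.cast_eq_zero.mp (congrFun h i)
  have h4 := E.abs_scale_pos ha hdet hmax
  have h5 := eps_le hn ha hdet
  have : 0 < (1 - eps a M) * |((E.t * M.det : ℤ) : ℝ)| * lpNorm 1 fun i => (v i : ℝ) :=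
    mul_pos (mul_pos (by linarith) h4) h3
  linarith

theorem map_M'_mulVec_x (h : E.M'.det ≠ 0) :
    (E.M'.map (Int.cast : ℤ → ℚ)).mulVec E.x = fun i => (E.b i : ℚ) := by
  have h1 : (E.M'.map (Int.cast : ℤ → ℚ)).det = E.M'.det :=
    (RingHom.map_det (Int.castRingHom ℚ) E.M').symm
  have h2 : (E.M'.map (Int.cast : ℤ → ℚ)).det ≠ 0 := by
    rw [h1]
    exact Int.cast_ne_zero.mpr h
  rw [x, Matrix.mulVec_mulVec, Matrix.mul_nonsing_inv _ (isUnit_iff_ne_zero.mpr h2),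
    Matrix.one_mulVec]

/-- Since `det M' e₁` lies in the lattice of `M'`, the determinant of `M'` is large. -/
theorem two_mul_le_abs_det_M' (ha : 1 ≤ a) (hdet : M.det ≠ 0)
    (hmax : ∀ i k, |M i k| ≤ bottomLeft hn M) : 2 * (a : ℝ) ≤ |(E.M'.det : ℝ)| := by
  have hm : (1 : ℝ) ≤ bottomLeft hn M := by exact_mod_cast bottomLeft_pos hn hdet hmax
  have ha' : (1 : ℝ) ≤ a := by exact_mod_cast ha
  have hn' : (2 : ℝ) ≤ n := by exact_mod_cast hn
  have hdet' := E.det_M'_ne_zero ha hdet hmax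
  let e : Fin n → ℤ := Pi.single ⟨0, by omega⟩ 1
  have hTu : E.M'.mulVec (E.M'.adjugate.mulVec e) = E.M'.det • e := by
    rw [Matrix.mulVec_mulVec, Matrix.mul_adjugate, Matrix.smul_mulVec, Matrix.one_mulVec]
  set u := E.M'.adjugate.mulVec e
  have hu : u ≠ 0 := by
    intro h0
    rw [h0, Matrix.mulVec_zero] at hTu
    have := congrFun hTu ⟨0, by omega⟩
    simp only [e, Pi.zero_apply, Pi.smul_apply, Pi.single_eq_same, smul_eq_mul, mul_one] at this
    exact hdet' this.symm
  obtain ⟨i, hi⟩ := Function.ne_iff.mp hu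
  have hu1 : (1 : ℝ) ≤ lpNorm ∞ fun i => (u i : ℝ) := by
    have h1 : (1 : ℤ) ≤ |u i| := Int.one_le_abs hi
    have h2 : (1 : ℝ) ≤ |(u i : ℝ)| := by exact_mod_cast h1
    exact h2.trans (abs_le_lpNorm le_top (fun i => (u i : ℝ)) i)
  have hMe : ∀ i, M.mulVec (E.M'.det • e) i = E.M'.det * M i ⟨0, by omega⟩ := by
    intro i
    rw [Matrix.mulVec_smul, Pi.smul_apply, smul_eq_mul]
    simp [e]
  have h1 := (E.lpNorm_bounds (s := ∞) (by simp) ha hdet hmax fun i => (u i : ℝ)).1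
  rw [intCast_mulVec, ← Matrix.mulVec_mulVec, hTu] at h1
  have h2 : lpNorm ∞ (fun i => ((M.mulVec (E.M'.det • e) i : ℤ) : ℝ)) ≤
      |(E.M'.det : ℝ)| * bottomLeft hn M := by
    rw [lpNorm_top, pi_norm_le_iff_of_nonneg (by positivity)]
    intro i
    rw [hMe, Int.cast_mul, Real.norm_eq_abs, abs_mul]
    gcongr
    exact_mod_cast hmax i _
  have h3 := eps_le hn ha hdet
  have h4 := E.abs_scale_ge
  have h5 := eight_mul_le_pow hm rfl hn
  have h6 : (1 : ℝ) ≤ |(M.det : ℝ)| := by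
    have : (1 : ℤ) ≤ |M.det| := Int.one_le_abs hdet
    exact_mod_cast this
  set W := |((E.t * M.det : ℤ) : ℝ)|
  have h7 : 1 / 2 * W * 1 ≤ (1 - eps a M) * W * lpNorm ∞ fun i => (u i : ℝ) := by
    gcongr
    · exact mul_nonneg (by linarith) (abs_nonneg _)
    · linarith
  have h8 : (a : ℝ) * 1 * (8 * bottomLeft hn M * 1) * 1 ≤ W := by
    refine le_trans ?_ h4
    rw [sq]
    gcongr
    refine le_trans ?_ h5
    gcongr
    linarith
  have h9 : (2 * a) * (bottomLeft hn M : ℝ) ≤ |(E.M'.det : ℝ)| * bottomLeft hn M := by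
    have : (0 : ℝ) ≤ a * bottomLeft hn M := by positivity
    linarith
  exact le_of_mul_le_mul_right h9 (by linarith)

theorem span_eq (hdet' : E.M'.det ≠ 0) :
    Submodule.span ℤ (Set.range (M * E.M').col ∪ {M.mulVec E.b}) =
      Submodule.span ℤ (Set.range M.col) := by
  rw [← Matrix.range_mulVecLin]
  apply le_antisymm
  · rw [Submodule.span_le]
    rintro _ (⟨k, rfl⟩ | hb)
    · refine ⟨E.M'.col k, ?_⟩
      ext i
      simp [Matrix.mulVec, dotProduct, Matrix.mul_apply]
    · rw [Set.mem_singleton_iff.mp hb]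
      exact ⟨E.b, rfl⟩
  · rintro _ ⟨v, rfl⟩
    obtain ⟨q, k, rfl⟩ := exists_eq_smul_add_mulVec hdet' E.adjugate_mulVec_b v
    rw [map_add, map_smul]
    refine Submodule.add_mem _ (Submodule.smul_mem _ _ (Submodule.subset_span (Or.inr rfl))) ?_
    have h1 : M.mulVecLin (E.M'.mulVec k) = (M * E.M').mulVecLin k := by
      simp [Matrix.mulVec_mulVec]
    have h2 : M.mulVecLin (E.M'.mulVec k) ∈ Submodule.span ℤ (Set.range (M * E.M').col) := by
      rw [h1, ← Matrix.range_mulVecLin]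
      exact ⟨k, rfl⟩
    exact Submodule.span_mono Set.subset_union_left h2

/-! ### The two oracles -/

section Oracle

variable {s : ℝ≥0∞}

theorem exists_isSVPSolution (hs : s = 1 ∨ s = 2 ∨ s = ∞) {d : ℕ} (hd : 0 < d) (ha : 1 ≤ a)
    (hdet : M.det ≠ 0) (hmax : ∀ i k, |M i k| ≤ bottomLeft hn M)
    {q₀ : ℤ} (hq₀ : 0 < fracNorm s q₀ E.x)
    (hopt : ∀ q, 0 < fracNorm s q E.x → fracNorm s q E.x ≤ 1 / (4 * a) →
      fracNorm s q₀ E.x ≤ (a : ℝ) / d * fracNorm s q E.x) :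
    ∃ v : Fin n → ℤ, E.result q₀ = (fun i => (v i : ℚ)) ∧ IsSVPSolution s ((a : ℝ) / d) M v := by
  have hdet' := E.det_M'_ne_zero ha hdet hmax
  have hx := E.map_M'_mulVec_x hdet'
  exact ⟨latticeVec E.M' E.b E.x q₀, mulVec_fracVec hx q₀,
    isSVPSolution_latticeVec hs (by omega) hd ha hdet hdet' hx E.adjugate_mulVec_b
      (one_le_root_det hdet) (exists_mulVec_le (by omega) M hdet) (E.abs_scale_ge' ha hdet hmax)
      rfl (eps_le hn ha hdet) (E.lpNorm_bounds hs ha hdet hmax) hq₀ hopt⟩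

theorem exists_isSAPSolution_sapInput (hs : s = 1 ∨ s = 2 ∨ s = ∞) (ha : 1 ≤ a)
    (hdet : M.det ≠ 0) (hmax : ∀ i k, |M i k| ≤ bottomLeft hn M) {α : ℝ} (hα : 1 ≤ α) :
    ∃ q, IsSAPSolution s (E.sapInput α) q := by
  have hdet' := E.det_M'_ne_zero ha hdet hmax
  have hx := E.map_M'_mulVec_x hdet'
  have hρ := one_le_root_det hdet
  obtain ⟨v, hv0, hv⟩ := exists_mulVec_le (by omega) M hdet
  obtain ⟨q, hq, -⟩ := exists_short_multiple hs (by omega) ha hdet' hx E.adjugate_mulVec_b hρ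
    (E.abs_scale_ge' ha hdet hmax) (eps_le hn ha hdet)
    (fun u => (E.lpNorm_bounds hs ha hdet hmax u).1) (latNorm_pos (one_le_of_mem hs) hdet hv0)
    (lpNorm_le_of_forall hs (by linarith) hv)
  exact exists_isSAPSolution hdet' hx hq hα

theorem one_le_gda_bound (ha : 1 ≤ a) {d : ℕ} (hd : 0 < d)
    (hdet : M.det ≠ 0) (hmax : ∀ i k, |M i k| ≤ bottomLeft hn M) :
    1 ≤ (n : ℝ) ^ (s⁻¹).toReal * |(E.M'.det : ℝ)| / (2 * ((a : ℝ) / d)) := by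
  have h1 := E.two_mul_le_abs_det_M' ha hdet hmax
  have ha' : (1 : ℝ) ≤ a := by exact_mod_cast ha
  have hd' : (1 : ℝ) ≤ d := by exact_mod_cast hd
  have hc : 1 ≤ (n : ℝ) ^ (s⁻¹).toReal := one_le_rpow_inv (by omega)
  rw [le_div_iff₀ (by positivity), one_mul]
  calc 2 * ((a : ℝ) / d) ≤ 2 * a := by
        gcongr
        exact div_le_self (by linarith) hd'
    _ ≤ 1 * |(E.M'.det : ℝ)| := by linarith
    _ ≤ _ := by gcongr

/-- A valid output `q₀` is at most `|det M'| / 2`, so `{q₀ x}` does not vanish; and every small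
`{q x}` is, up to sign, one of those with a factor within the bound of the problem. -/
theorem exists_isSVPSolution_of_isGDASolution (hs : s = 1 ∨ s = 2 ∨ s = ∞) {d : ℕ} (hd : 0 < d)
    (ha : 1 ≤ a) (hdet : M.det ≠ 0) (hmax : ∀ i k, |M i k| ≤ bottomLeft hn M)
    {q₀ : ℤ} (h : IsGDASolution s (E.gdaInput s ((a : ℝ) / d)) q₀) :
    ∃ v : Fin n → ℤ, E.result q₀ = (fun i => (v i : ℚ)) ∧ IsSVPSolution s ((a : ℝ) / d) M v := by
  have hs1 := one_le_of_mem hs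
  have hdet' := E.det_M'_ne_zero ha hdet hmax
  have hx := E.map_M'_mulVec_x hdet'
  have ha' : (1 : ℝ) ≤ a := by exact_mod_cast ha
  have hd' : (1 : ℝ) ≤ d := by exact_mod_cast hd
  have hc : 1 ≤ (n : ℝ) ^ (s⁻¹).toReal := one_le_rpow_inv (by omega)
  obtain ⟨⟨hq1, hq2⟩, hopt⟩ := h
  simp only [gdaInput] at hq2 hopt
  set c := (n : ℝ) ^ (s⁻¹).toReal with hcdef
  have hdetpos : 0 < |(E.M'.det : ℝ)| := abs_pos.mpr (Int.cast_ne_zero.mpr hdet')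
  have hq3 : (q₀ : ℝ) ≤ |(E.M'.det : ℝ)| / 2 := by
    have h1 := Int.le_floor.mp hq2
    refine h1.trans (le_of_eq ?_)
    field_simp
  have hq4 : q₀ < |E.M'.det| := by
    have h1 : (q₀ : ℝ) < ((|E.M'.det| : ℤ) : ℝ) := by
      rw [Int.cast_abs]
      linarith
    exact_mod_cast h1
  refine E.exists_isSVPSolution hs hd ha hdet hmax
    (fracNorm_pos_of_lt hx E.adjugate_mulVec_b hs1 hq1 hq4) fun q hq hqs => ?_
  have hη : (1 : ℝ) / (4 * a) < 1 / 2 := by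
    apply one_div_lt_one_div_of_lt <;> linarith
  obtain ⟨r, hr1, hr2, hr⟩ := exists_small_multiple hdet' hx E.adjugate_mulVec_b hs1 hq hqs hη
  have hrN : r ∈ bracket (c * |(E.M'.det : ℝ)| / (2 * ((a : ℝ) / d))) := by
    refine ⟨hr1, Int.le_floor.mpr (hr2.trans ?_)⟩
    rw [le_div_iff₀ (by positivity)]
    calc 1 / (4 * (a : ℝ)) * |(E.M'.det : ℝ)| * (2 * ((a : ℝ) / d))
        = |(E.M'.det : ℝ)| / (2 * d) := by field_simp; norm_num
      _ ≤ |(E.M'.det : ℝ)| := div_le_self hdetpos.le (by linarith)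
      _ ≤ c * |(E.M'.det : ℝ)| := le_mul_of_one_le_left hdetpos.le hc
  have h1 := hopt r hrN
  rw [hr] at h1
  refine h1.trans (mul_le_mul_of_nonneg_right (div_le_self (by positivity) hc) hq.le)

end Oracle

end Execution

end SVPReduction

theorem theorem1 (n : ℕ) (hn : 2 ≤ n) (s : ℝ≥0∞) (hs : s = 1 ∨ s = 2 ∨ s = ∞)
    (a b : ℕ) (hb : 0 < b) (hab : b ≤ a)
    (M : Matrix (Fin n) (Fin n) ℤ) (hdet : M.det ≠ 0)
    (hmax : ∀ i k, |M i k| ≤ SVPReduction.bottomLeft hn M) :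
    Nonempty (SVPReduction.Execution hn a M) ∧
    ∀ E : SVPReduction.Execution hn a M,
      -- the new matrix and the lattice that it generates together with one extra vector
      E.M'.det ≠ 0 ∧
      M * E.M' = (E.t * M.det) • (1 : Matrix (Fin n) (Fin n) ℤ) + M * E.A ∧
      SVPReduction.IsNearlyScaledOrthonormal s a |(M.det : ℝ)| (E.t * M.det) (M * E.A) ∧
      Submodule.span ℤ (Set.range (M * E.M').col ∪ {M.mulVec E.b}) =
        Submodule.span ℤ (Set.range M.col) ∧
      -- one call to a simultaneous approximation oracle with the same gap
      (∃ q, SVPReduction.IsSAPSolution s (E.sapInput ((a : ℝ) / b)) q) ∧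
      (∀ O : SVPReduction.SAPInput n → ℤ, SVPReduction.IsSAPOracle s O →
        (E.sapProgram ((a : ℝ) / b)).queries O = [⟨(a : ℝ) / b, E.x⟩] ∧
        ∃ q₀ : Fin n → ℤ, (E.sapProgram ((a : ℝ) / b)).output O = (fun i => (q₀ i : ℚ)) ∧
          SVPReduction.IsSVPSolution s ((a : ℝ) / b) M q₀) ∧
      -- one call to a good Diophantine approximation oracle with the gap divided by `n ^ (1 / s)`
      1 ≤ (n : ℝ) ^ (s⁻¹).toReal * |(E.M'.det : ℝ)| / (2 * ((a : ℝ) / b)) ∧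
      ((n : ℝ) ^ (s⁻¹).toReal ≤ (a : ℝ) / b →
        ∀ O : SVPReduction.GDAInput n → ℤ, SVPReduction.IsGDAOracle s O →
          (E.gdaProgram s ((a : ℝ) / b)).queries O =
            [⟨(a : ℝ) / b / (n : ℝ) ^ (s⁻¹).toReal, E.x,
              (n : ℝ) ^ (s⁻¹).toReal * |(E.M'.det : ℝ)| / (2 * ((a : ℝ) / b))⟩] ∧
          ∃ q₀ : Fin n → ℤ, (E.gdaProgram s ((a : ℝ) / b)).output O = (fun i => (q₀ i : ℚ)) ∧
            SVPReduction.IsSVPSolution s ((a : ℝ) / b) M q₀) := by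
  have ha : 1 ≤ a := hb.trans_le hab
  have hα : 1 ≤ (a : ℝ) / b :=
    (one_le_div (by exact_mod_cast hb)).mpr (by exact_mod_cast hab)
  refine ⟨SVPReduction.nonempty_execution hn M ha hdet hmax, fun E => ?_⟩
  have hdet' := E.det_M'_ne_zero ha hdet hmax
  have hsap := E.exists_isSAPSolution_sapInput hs ha hdet hmax hα
  have hN := E.one_le_gda_bound (s := s) ha hb hdet hmax
  refine ⟨hdet', E.mul_M', E.isNearlyScaledOrthonormal hs ha hdet hmax, E.span_eq hdet', hsap,
    fun O hO => ⟨rfl, ?_⟩, hN, fun hc O hO => ⟨rfl, ?_⟩⟩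
  · obtain ⟨h1, h2⟩ := hO (E.sapInput ((a : ℝ) / b)) hα hsap
    exact E.exists_isSVPSolution hs hb ha hdet hmax h1 fun q hq _ => h2 q hq
  · have hc0 : 0 < (n : ℝ) ^ (s⁻¹).toReal :=
      lt_of_lt_of_le one_pos (SVPReduction.one_le_rpow_inv (by omega))
    exact E.exists_isSVPSolution_of_isGDASolution hs hb ha hdet hmax
      (hO (E.gdaInput s ((a : ℝ) / b)) ((one_le_div hc0).mpr hc) hN)
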